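/- **Setting.** Let $n\ge 1$, $X\subseteq\mathbb R^n$ with the Euclidean distance, $Y$ a finite set of actions, $\Pi$ a class of policies $X\to Y$, and $\pi^m\in\Pi$ the mentor's policy. At each time $t=1,\dots,T$ an adaptive adversary, who may use randomness and all events of earlier time steps, chooses an input $x_t\in X$ and a payoff function $\mu_t:X\times Y\to[0,1]$. The agent sees $x_t$ and either takes an action $y_t\in Y$ and gets payoff $\mu_t(x_t,y_t)$, or queries the mentor, observes $\pi^m(x_t)$ and gets payoff $\mu_t(x_t,\pi^m(x_t))$. The agent never observes payoffs. Write $a_t$ for the agent's payoff, $\mu^m_t=\mu_t(x_t,\pi^m(x_t))$, $Q_T$ for the set of times with a query, and $\mathrm{diam}(x)$ for the diameter of $\{x_1,\dots,x_T\}$. Assume that, for constants $L>0$ and $\mu_0^m>0$, always $\mu_t^m\ge\mu_0^m$ and $|\mu_t(z,\pi^m(z))-\mu_t(z,\pi^m(z'))|\le L\|z-z'\|$ for all $z,z'\in X$ (local generalization). The regrets are $$R^+_T=\sum_{t\le T}\mu_t^m-\sum_{t\le T}a_t,\qquad R^\times_T=\log\prod_{t\le T}\mu_t^m-\log\prod_{t\le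 T}a_t,$$ with $R_T^\times=\infty$ if some $a_t=0$. For a probability measure $U$ on $X$ (for instance the uniform one) and $\sigma\in(0,1]$, the input sequence is $\sigma$-smooth if, conditionally on the events of the earlier time steps, $x_t$ has a distribution $D_t$ with $D_t(S)\le U(S)/\sigma$ for all measurable $S$. For $y\in Y$ and $\pi:X\to Y$ put $\pi_y(x)=\mathbf 1(\pi(x)=y)$, and let $\Pi_y=\{\pi_y:\pi\in\Pi\}$. An *expert* predicts a bit at time $t$ from $x_1,\dots,x_t$; a policy $X\to\{0,1\}$ is a special case. A finite set $C$ of measurable policies is a *smooth $\varepsilon$-cover* of $\Pi_y$ if every $h\in\Pi_y$ has some $c\in C$ with $U(c\ne h)\le\varepsilon$. A finite set $C$ of experts is an *adversarial cover* of $\Pi_y$ if, for every $x\in X^T$ and $h\in\Pi_y$, some $c\in C$ predicts $h(x_t)$ at every time $t\le T$. **Algorithm.** Inputs: $T$, $\varepsilon\in(0,1]$, with $\varepsilon\ge 1/T$, and for each $y\in Y$ a cover $C_y$ of $\Pi_y$. Put $p=1/\sqrt{\varepsilon T}$ and $\eta_y=\max\big(\sqrt{p\log|C_y|/(2T)},\,p^2/\sqrt2\big)$.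 For each $y$ run one copy of the following binary algorithm, with all coins and samples independent. It starts with weights $w_y(c)=1$ for $c\in C_y$ and a set $S_y=\emptyset$ of examples. At time $t$: 1. With probability $p$ the copy makes a Hedge query: it asks the mentor, computes $\ell(c)=\mathbf 1(c\text{ mispredicts }\pi^m_y(x_t))$ and $\ell^*=\min_{c\in C_y}\ell(c)$, selects any $c_t^y$ with $\ell(c^y_t)=\ell^*$, and replaces $w_y(c)$ by $w_y(c)\exp\!\big(-\eta_y(\ell(c)-\ell^*)/p\big)$ for every $c\in C_y$. Otherwise it samples $c_t^y\in C_y$ with probability proportional to $w_y$. Let $b$ be the bit that $c_t^y$ predicts. 2. If no $(x',b')\in S_y$ with $b'=b$ has $\|x_t-x'\|\le\varepsilon^{1/n}$, the copy asks the mentor (if it has not yet done so) and adds $(x_t,\pi^m_y(x_t))$ to $S_y$. 3. If it has not asked the mentor, it votes $b_t^y=b$. The agent queries the mentor at time $t$ if some copy asks. If no copy asks and $b_t^y=1$ for some $y$, the agent takes any such action $y$. If no copy asks and all votes are $0$, it takes any action that it has seen the mentor take at an input recorded in some $S_y$ within distance $\varepsilon^{1/n}$ of $x_t$ (such an action then exists).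 **Theorem.** For every $n\ge1$ there is a constant $K>0$ depending only on $n$, and for all $L,\mu_0^m>0$ there is a $T_0$ depending only on $n,L,\mu_0^m$, such that the following holds for all $X,Y,\Pi,\pi^m,U$ as above, all integers $d\ge1$ and $T\ge2$, and $\varepsilon=T^{-2n/(2n+1)}$. (a) The covers exist: if $\Pi_y$ consists of measurable functions and has VC dimension at most $d$, then it has a smooth $\varepsilon$-cover of size at most $(41/\varepsilon)^d$; if $\Pi_y$ has Littlestone dimension at most $d$, then it has an adversarial cover of size at most $(e\max(T,d)/d)^d$, which is $(eT/d)^d$ when $T\ge d$. (b) Let $\sigma\in(0,1]$. Suppose that for each $y\in Y$ either (1) $\Pi_y$ consists of measurable functions and has VC dimension at most $d$, the input sequence is $\sigma$-smooth, and $C_y$ is any smooth $\varepsilon$-cover of $\Pi_y$ of size at most $(41/\varepsilon)^d$; or (2) $\Pi_y$ has Littlestone dimension at most $d$ and $C_y$ is any adversarial cover of $\Pi_y$ of size at most $(e\max(T,d)/d)^d$. Then against every such adversary the algorithm satisfies $$\mathbb E[R_T^\times]\le K\,\frac{|Y|\,d\,L}{\sigma\mu_0^m}\,T^{-1/(2n+1)}\log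 T\quad\text{if }T\ge T_0,$$ $$\mathbb E[R_T^+]\le K\,\frac{|Y|\,d\,L}{\sigma}\,T^{-1/(2n+1)}\log T,$$ $$\mathbb E[|Q_T|]\le K\,|Y|\,T^{\frac{4n+1}{4n+2}}\Big(\frac d\sigma\log T+\mathbb E[\mathrm{diam}(x)^n]\Big),$$ where $R_T^\times$ is almost surely finite for $T\ge T_0$ and both regrets are integrable. All measurability needed for these quantities to make sense is assumed. -/

import Mathlib

open MeasureTheory

namespace AskForHelp

noncomputable section

/-! ### Binary classes, combinatorial dimensions -/

/-- The class `H` of binary functions realizes every labelling of the finite set `A`. -/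
def Shatters {X : Type*} (H : Set (X → Bool)) (A : Finset X) : Prop :=
  ∀ g : X → Bool, ∃ h ∈ H, ∀ a ∈ A, h a = g a

/-- The VC dimension: supremum of the sizes of finite shattered sets. -/
def vcDim {X : Type*} (H : Set (X → Bool)) : ℕ∞ :=
  ⨆ (A : Finset X) (_ : Shatters H A), (A.card : ℕ∞)

/-- `H` shatters a complete binary mistake tree of depth `m`: the root carries a point `x`, and the
subclasses of `H` with value `true` and `false` at `x` shatter the two subtrees of depth `m - 1`. -/
def ShattersTree {X : Type*} : ℕ → Set (X → Bool) → Prop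
  | 0, H => H.Nonempty
  | m + 1, H => ∃ x : X, ShattersTree m {h ∈ H | h x = true} ∧ ShattersTree m {h ∈ H | h x = false}

/-- The Littlestone dimension: supremum of the depths of shattered mistake trees. -/
def littlestoneDim {X : Type*} (H : Set (X → Bool)) : ℕ∞ :=
  ⨆ (m : ℕ) (_ : ShattersTree m H), (m : ℕ∞)

open Classical in
/-- The binary policy `x ↦ 1(π x = y)`. -/
def indicatorPolicy {X Y : Type*} (π : X → Y) (y : Y) : X → Bool := fun x => decide (π x = y)

/-- The class `Π_y` of the policies `x ↦ 1(π x = y)`, `π ∈ Pol`. -/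
def oneVsRest {X Y : Type*} (Pol : Set (X → Y)) (y : Y) : Set (X → Bool) :=
  (fun π => indicatorPolicy π y) '' Pol

/-! ### Experts and covers -/

/-- An expert predicts a bit from the list of the previous inputs and the current input. A policy
`g : X → Bool` is the special case of an expert that ignores the previous inputs. -/
abbrev Expert (X : Type*) := List X → X → Bool

/-- The prediction of the expert `e` at time `t` on the input sequence `xs`. -/
def predict {X : Type*} (e : Expert X) (xs : ℕ → X) (t : ℕ) : Bool :=
  e ((List.range t).map xs) (xs t)

/-- `C` is a smooth `ε`-cover of `H` (with respect to `U`) made of measurable policies. -/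
def IsSmoothCover {X : Type*} [MeasurableSpace X] (U : Measure X) (ε : ℝ)
    (H : Set (X → Bool)) (C : Finset (Expert X)) : Prop :=
  (∀ e ∈ C, ∃ g : X → Bool, Measurable g ∧ e = fun _ x => g x) ∧
  ∀ h ∈ H, ∃ e ∈ C, U {x | e [] x ≠ h x} ≤ ENNReal.ofReal ε

/-- `C` is an adversarial cover of `H` for the horizon `T`: on every input sequence, every member
of `H` agrees with some expert of `C` at all the times `0, …, T - 1`. -/
def IsAdversarialCover {X : Type*} (T : ℕ) (H : Set (X → Bool)) (C : Finset (Expert X)) : Prop :=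
  ∀ xs : ℕ → X, ∀ h ∈ H, ∃ e ∈ C, ∀ t < T, predict e xs t = h (xs t)

/-- Size allowed for a smooth `ε`-cover. -/
def smoothCoverSize (d : ℕ) (ε : ℝ) : ℝ := (41 / ε) ^ d

/-- Size allowed for an adversarial cover. It is `(e T / d) ^ d` whenever `d ≤ T`. -/
def adversarialCoverSize (d T : ℕ) : ℝ := (Real.exp 1 * (max T d : ℕ) / d) ^ d

/-! ### The binary algorithm

Everything here is a deterministic function of one realization: `xs` are the inputs, `f` is the
binary mentor policy, `C` the cover, `coin t` says whether Hedge queries at time `t`, and `pol t` is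
the expert that Hedge selects at time `t`. Time runs through `0, …, T - 1`. -/

/-- The probability `p = 1 / √(ε T)` of a Hedge query. -/
def queryProb (T : ℕ) (ε : ℝ) : ℝ := 1 / Real.sqrt (ε * T)

/-- The learning rate `η`, for a cover of size `N`. -/
def learningRate (T : ℕ) (ε : ℝ) (N : ℕ) : ℝ :=
  max (Real.sqrt (queryProb T ε * Real.log N / (2 * T))) (queryProb T ε ^ 2 / Real.sqrt 2)

/-- The loss `ℓ(t, e)`. -/
def loss {X : Type*} (f : X → Bool) (xs : ℕ → X) (t : ℕ) (e : Expert X) : ℝ :=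
  if predict e xs t = f (xs t) then 0 else 1

/-- The least loss `ℓ*` of an expert of `C` at time `t`. -/
def bestLoss {X : Type*} (C : Finset (Expert X)) (f : X → Bool) (xs : ℕ → X) (t : ℕ) : ℝ :=
  sInf ((fun e => loss f xs t e) '' (C : Set (Expert X)))

/-- The Hedge weight of `e` at the start of time `t`. On a query, the importance-weighted loss
`(ℓ - ℓ*) / p` is charged at the rate `η`. -/
def weight {X : Type*} (T : ℕ) (ε : ℝ) (C : Finset (Expert X)) (f : X → Bool)
    (xs : ℕ → X) (coin : ℕ → Bool) : ℕ → Expert X → ℝ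
  | 0, _ => 1
  | t + 1, e =>
      if coin t = true then
        weight T ε C f xs coin t e *
          Real.exp (-(learningRate T ε C.card *
            ((loss f xs t e - bestLoss C f xs t) / queryProb T ε)))
      else weight T ε C f xs coin t e

/-- The probability with which Hedge samples `e` at time `t`. -/
def hedgeProb {X : Type*} (T : ℕ) (ε : ℝ) (C : Finset (Expert X)) (f : X → Bool)
    (xs : ℕ → X) (coin : ℕ → Bool) (t : ℕ) (e : Expert X) : ℝ :=
  weight T ε C f xs coin t e / ∑ e' ∈ C, weight T ε C f xs coin t e'

/-- Every recorded example with label `b` is farther than `r` from `x`. -/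
def IsFar {X : Type*} [Dist X] (r : ℝ) (S : Set (X × Bool)) (x : X) (b : Bool) : Prop :=
  ∀ s ∈ S, s.2 = b → r < dist x s.1

/-- The set `S` of recorded examples at the start of time `t`; `r` is the distance threshold. -/
def recorded {X : Type*} [Dist X] (r : ℝ) (f : X → Bool) (xs : ℕ → X) (pol : ℕ → Expert X) :
    ℕ → Set (X × Bool)
  | 0 => ∅
  | t + 1 => recorded r f xs pol t ∪
      {s | s = (xs t, f (xs t)) ∧
        IsFar r (recorded r f xs pol t) (xs t) (predict (pol t) xs t)}

/-- The copy asks the mentor at time `t`: Hedge queries, or the input is far from all the recorded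
examples whose label is the proposed bit. If it does not ask, its vote is `predict (pol t) xs t`. -/
def Asks {X : Type*} [Dist X] (r : ℝ) (f : X → Bool) (xs : ℕ → X) (coin : ℕ → Bool)
    (pol : ℕ → Expert X) (t : ℕ) : Prop :=
  coin t = true ∨ IsFar r (recorded r f xs pol t) (xs t) (predict (pol t) xs t)

/-! ### The interaction of the many-action algorithm with an adaptive adversary -/

/-- The random objects of an interaction, on a sample space `Ω`. -/
structure Interaction (Ω X Y : Type*) where
  /-- the events of the time steps before `t` -/
  past : ℕ → MeasurableSpace Ω
  /-- the events of the time steps before `t` and the adversary's choices at time `t` -/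
  present : ℕ → MeasurableSpace Ω
  /-- the input `x_t` -/
  input : ℕ → Ω → X
  /-- the payoff function `μ_t` -/
  payoff : ℕ → Ω → X → Y → ℝ
  /-- does Hedge query at time `t` in copy `y`? -/
  coin : ℕ → Ω → Y → Bool
  /-- the sample from the Hedge distribution of copy `y` (used if Hedge does not query) -/
  draw : ℕ → Ω → Y → Expert X
  /-- the expert selected by Hedge in copy `y` -/
  policy : ℕ → Ω → Y → Expert X
  /-- the action in `Y` that the agent takes at time `t` if it does not query -/
  action : ℕ → Ω → Y

namespace Interaction

variable {Ω X Y : Type*}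

/-- The input sequence of one realization. -/
def inputs (I : Interaction Ω X Y) (ω : Ω) : ℕ → X := fun t => I.input t ω

/-- The set `S` of copy `y` at the start of time `t`, with distance threshold `r`. -/
def examples [Dist X] (I : Interaction Ω X Y) (mentor : X → Y) (r : ℝ) (t : ℕ) (ω : Ω) (y : Y) :
    Set (X × Bool) :=
  recorded r (indicatorPolicy mentor y) (I.inputs ω) (fun s => I.policy s ω y) t

/-- Copy `y` asks the mentor at time `t`. -/
def CopyAsks [Dist X] (I : Interaction Ω X Y) (mentor : X → Y) (r : ℝ) (t : ℕ) (ω : Ω) (y : Y) :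
    Prop :=
  Asks r (indicatorPolicy mentor y) (I.inputs ω) (fun s => I.coin s ω y)
    (fun s => I.policy s ω y) t

/-- The bit proposed by copy `y` at time `t`. -/
def proposal (I : Interaction Ω X Y) (t : ℕ) (ω : Ω) (y : Y) : Bool :=
  predict (I.policy t ω y) (I.inputs ω) t

/-- The agent queries the mentor at time `t`: some copy asks. -/
def Queries [Dist X] (I : Interaction Ω X Y) (mentor : X → Y) (r : ℝ) (t : ℕ) (ω : Ω) : Prop :=
  ∃ y, I.CopyAsks mentor r t ω y

/-- The number `|Q_T|` of queries. -/
def queryCount [Dist X] (I : Interaction Ω X Y) (mentor : X → Y) (r : ℝ) (T : ℕ) (ω : Ω) : ℕ :=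
  {t : ℕ | t < T ∧ I.Queries mentor r t ω}.ncard

/-- The mentor's payoff at time `t`. -/
def mentorPayoff (I : Interaction Ω X Y) (mentor : X → Y) (t : ℕ) (ω : Ω) : ℝ :=
  I.payoff t ω (I.input t ω) (mentor (I.input t ω))

open Classical in
/-- The agent's payoff at time `t`: the mentor's payoff after a query. -/
def agentPayoff [Dist X] (I : Interaction Ω X Y) (mentor : X → Y) (r : ℝ) (t : ℕ) (ω : Ω) : ℝ :=
  if I.Queries mentor r t ω then I.mentorPayoff mentor t ω
  else I.payoff t ω (I.input t ω) (I.action t ω)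

/-- The additive regret. -/
def additiveRegret [Dist X] (I : Interaction Ω X Y) (mentor : X → Y) (r : ℝ) (T : ℕ) (ω : Ω) : ℝ :=
  ∑ t ∈ Finset.range T, I.mentorPayoff mentor t ω -
    ∑ t ∈ Finset.range T, I.agentPayoff mentor r t ω

open Classical in
/-- The multiplicative regret, infinite if the agent's payoff vanishes at some time. -/
def multiplicativeRegret [Dist X] (I : Interaction Ω X Y) (mentor : X → Y) (r : ℝ) (T : ℕ) (ω : Ω) :
    EReal :=
  if ∃ t < T, I.agentPayoff mentor r t ω = 0 then ⊤
  else ((Real.log (∏ t ∈ Finset.range T, I.mentorPayoff mentor t ω) -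
    Real.log (∏ t ∈ Finset.range T, I.agentPayoff mentor r t ω) : ℝ) : EReal)

/-- The diameter of the set of the inputs `x_0, …, x_{T-1}`. -/
def inputDiam [PseudoMetricSpace X] (I : Interaction Ω X Y) (T : ℕ) (ω : Ω) : ℝ :=
  Metric.diam (I.inputs ω '' Set.Iio T)

/-- `I` is an execution, up to the horizon `T`, of the many-action algorithm with parameter `ε`,
distance threshold `r` and covers `cover y`, against an adaptive adversary. -/
structure IsExecution [MetricSpace X] [MeasurableSpace X] [Fintype Y] [MeasurableSpace Ω]
    (P : Measure Ω) (I : Interaction Ω X Y) (mentor : X → Y) (T : ℕ) (ε r : ℝ)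
    (cover : Y → Finset (Expert X)) : Prop where
  -- the order of events: the adversary moves at time `t`, then the agent, then time `t + 1`
  past_le_present : ∀ t < T, I.past t ≤ I.present t
  present_le_past : ∀ t < T, I.present t ≤ I.past (t + 1)
  past_le : ∀ t ≤ T, I.past t ≤ (inferInstance : MeasurableSpace Ω)
  -- the adversary's choices at time `t` and their evaluations are known before the agent moves
  measurable_input : ∀ t < T, Measurable[I.present t] (I.input t)
  measurable_payoff : ∀ t < T, ∀ y, Measurable[I.present t] fun ω => I.payoff t ω (I.input t ω) y
  measurable_mentor : ∀ t < T, ∀ y, MeasurableSet[I.present t] {ω | mentor (I.input t ω) = y}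
  measurable_predict : ∀ t < T, ∀ y, ∀ e ∈ cover y,
    MeasurableSet[I.present t] {ω | predict e (I.inputs ω) t = true}
  -- the agent's random choices and decisions are known after time `t`
  measurable_coin : ∀ t < T, ∀ y, MeasurableSet[I.past (t + 1)] {ω | I.coin t ω y = true}
  measurable_draw : ∀ t < T, ∀ y, ∀ e ∈ cover y,
    MeasurableSet[I.past (t + 1)] {ω | I.draw t ω y = e}
  measurable_policy : ∀ t < T, ∀ y, ∀ e ∈ cover y,
    MeasurableSet[I.past (t + 1)] {ω | I.policy t ω y = e}
  measurable_action : ∀ t < T, ∀ y, MeasurableSet[I.past (t + 1)] {ω | I.action t ω = y}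
  draw_mem : ∀ t < T, ∀ ω y, I.draw t ω y ∈ cover y
  -- given the past and the adversary's choices at time `t`, the copies flip independent coins of
  -- bias `p` and, independently of these, draw independent samples from their Hedge distributions
  law : ∀ t < T, ∀ (q : Y → Bool) (e : Y → Expert X), (∀ y, e y ∈ cover y) →
    P[Set.indicator {ω | I.coin t ω = q ∧ I.draw t ω = e} (fun _ => (1 : ℝ)) | I.present t]
      =ᵐ[P] fun ω => ∏ y, (if q y = true then queryProb T ε else 1 - queryProb T ε) *
        hedgeProb T ε (cover y) (indicatorPolicy mentor y) (I.inputs ω)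
          (fun s => I.coin s ω y) t (e y)
  -- Hedge selects an expert of least loss if it queries, and the sample otherwise
  policy_query : ∀ t < T, ∀ ω y, I.coin t ω y = true → I.policy t ω y ∈ cover y ∧
    ∀ e ∈ cover y, loss (indicatorPolicy mentor y) (I.inputs ω) t (I.policy t ω y) ≤
      loss (indicatorPolicy mentor y) (I.inputs ω) t e
  policy_draw : ∀ t < T, ∀ ω y, I.coin t ω y = false → I.policy t ω y = I.draw t ω y
  -- if no copy asks and some copy votes for its action, the agent takes any such action
  action_vote : ∀ t < T, ∀ ω, ¬ I.Queries mentor r t ω → (∃ y, I.proposal t ω y = true) →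
    I.proposal t ω (I.action t ω) = true
  -- if no copy asks and no copy votes for its action, the agent takes any action that it has seen
  -- the mentor take at a recorded input within distance `r` of the current input
  action_fallback : ∀ t < T, ∀ ω, ¬ I.Queries mentor r t ω → (∀ y, I.proposal t ω y = false) →
    ∃ y, ∃ s ∈ I.examples mentor r t ω y,
      dist (I.input t ω) s.1 ≤ r ∧ I.action t ω = mentor s.1

/-- The input sequence is `σ`-smooth with respect to `U`: the conditional distribution of `x_t`
given the events of the previous time steps is at most `U / σ` on every measurable set. -/
def IsSmooth [MeasurableSpace X] [MeasurableSpace Ω] (P : Measure Ω) (I : Interaction Ω X Y)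
    (T : ℕ) (U : Measure X) (σ : ℝ) : Prop :=
  ∀ t < T, ∀ S : Set X, MeasurableSet S →
    P[Set.indicator (I.input t ⁻¹' S) (fun _ => (1 : ℝ)) | I.past t]
      ≤ᵐ[P] fun _ => (U S).toReal / σ

/-- The payoffs lie in `[0, 1]`. -/
def PayoffsInUnitInterval (I : Interaction Ω X Y) (T : ℕ) : Prop :=
  ∀ t < T, ∀ ω x y, 0 ≤ I.payoff t ω x y ∧ I.payoff t ω x y ≤ 1

/-- Local generalization with constant `L`. -/
def LocalGeneralization [Dist X] (I : Interaction Ω X Y) (mentor : X → Y) (T : ℕ) (L : ℝ) : Prop :=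
  ∀ t < T, ∀ ω x x', |I.payoff t ω x (mentor x) - I.payoff t ω x (mentor x')| ≤ L * dist x x'

/-- The mentor's payoff is always at least `m`. -/
def MentorAtLeast (I : Interaction Ω X Y) (mentor : X → Y) (T : ℕ) (m : ℝ) : Prop :=
  ∀ t < T, ∀ ω, m ≤ I.mentorPayoff mentor t ω

end Interaction

/-- The choice `ε = T ^ (-2n / (2n + 1))`. -/
def epsilon (n T : ℕ) : ℝ := (T : ℝ) ^ (-(2 * n : ℝ) / (2 * n + 1))

/-- The distance threshold `ε ^ (1 / n)` for this `ε`. -/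
def threshold (n T : ℕ) : ℝ := epsilon n T ^ (1 / n : ℝ)

end

end AskForHelp

/-!
A copy of the binary algorithm works with a cover of the class `Π_y`, and the whole guarantee
follows from a bound for the expected number of its mistakes, that is, of its wrong proposals.

*Mistakes.* Hedge is analysed through the logarithm of the total weight. Charging only the excess
`ℓ - ℓ*` of the loss over the least loss makes the potential drop on a query by at least
`(1 - exp (-η / p))` times the mean excess loss of the Hedge distribution (`sum_hedgeGap_mul_le`).
Queries are independent coins of bias `p`, so that taking expectations bounds the sum of the mean
excess losses at all times by a multiple of `log |C| / p ^ 2` and of the loss of a good expert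
(`le_of_rate_inequality`). A good expert exists on every realization: for an adversarial cover it
makes no mistake, for a smooth cover it makes at most `ε T / σ` expected mistakes. As
`1 / p ^ 2 = ε T`, a copy makes `O (ε T (d / σ) log T)` expected mistakes
(`sum_integral_mistake_le_rate`).

*Regret.* An action taken without a query is the mentor's action at an input within distance
`r = ε ^ (1 / n)`, so it costs at most `L r`, and it costs nothing if all proposals are right. The
choice of `ε` makes `r ε T = T ^ (-1 / (2 n + 1))`. For `L r ≤ m / 2` the agent's payoff stays
above `m / 2`, and the logarithmic regret is at most `2 / m` times the same bound.

*Queries.* A copy asks because of a coin, or because the input is far from the recorded examples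
with the proposed label. In the second case the proposal is a mistake or the recorded inputs with
this label are `r`-separated, and their number is bounded by volume (`card_isFar_le`).

*Covers.* For Littlestone classes the experts are built by recursion on the horizon, and are
counted by Pascal's rule (`exists_adversarialCover_family`). For VC classes a maximal packing is a
cover, and Haussler's argument bounds packings without a logarithmic factor
(`card_le_of_separated`): the traces of the class on a random sample span few edges of the cube
(`sum_edgeWeight_le`), while a fresh sample point separates many pairs with equal traces on the
others (`le_integral_edgeWeight`).
-/

namespace AskForHelp

/-! ### The growth function and adversarial covers -/

/-- `growth m k` is the sum of the binomial coefficients `m.choose i` over `i < k`, defined through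
Pascal's rule. It bounds both the number of traces on `m` points of a class that shatters no set of
size `k`, and the size of an adversarial cover for the horizon `m` of a class that shatters no tree
of depth `k`. -/
def growth : ℕ → ℕ → ℕ
  | _, 0 => 0
  | 0, _ + 1 => 1
  | m + 1, k + 1 => growth m (k + 1) + growth m k

@[simp] lemma growth_zero_right (m : ℕ) : growth m 0 = 0 := by cases m <;> rfl

lemma pow_mul_growth_le {a : ℝ} (ha : 0 ≤ a) (h : a ≤ 1) (m d : ℕ) :
    a ^ d * growth m (d + 1) ≤ (1 + a) ^ m := by
  induction m generalizing d with
  | zero => simpa [growth] using pow_le_one₀ ha h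
  | succ m ih =>
    have h1 := ih d
    have h2 : a ^ d * (growth m d : ℝ) ≤ a * (1 + a) ^ m := by
      cases d with
      | zero => simp only [growth_zero_right, Nat.cast_zero, mul_zero]; positivity
      | succ d =>
        calc a ^ (d + 1) * (growth m (d + 1) : ℝ) = a * (a ^ d * growth m (d + 1)) := by ring
          _ ≤ a * (1 + a) ^ m := mul_le_mul_of_nonneg_left (ih d) ha
    simp only [growth, Nat.cast_add, pow_succ (1 + a)]
    linarith

/-- The classical estimate `∑ i ≤ d, m.choose i ≤ (e z / d) ^ d` for real `z ≥ m, d`. -/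
lemma growth_le {m d : ℕ} {z : ℝ} (hd : 1 ≤ d) (hz : (d : ℝ) ≤ z) (hm : (m : ℝ) ≤ z) :
    (growth m (d + 1) : ℝ) ≤ (Real.exp 1 * z / d) ^ d := by
  have hd0 : (0 : ℝ) < d := by exact_mod_cast hd
  have hz0 : 0 < z := hd0.trans_le hz
  have ha : 0 < (d : ℝ) / z := by positivity
  have ha1 : (d : ℝ) / z ≤ 1 := (div_le_one hz0).2 hz
  have h := pow_mul_growth_le ha.le ha1 m d
  have h2 : (1 + (d : ℝ) / z) ^ m ≤ Real.exp 1 ^ d := by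
    calc (1 + (d : ℝ) / z) ^ m ≤ Real.exp ((d : ℝ) / z) ^ m := by
          gcongr; linarith [Real.add_one_le_exp ((d : ℝ) / z)]
      _ = Real.exp (m * ((d : ℝ) / z)) := (Real.exp_nat_mul _ _).symm
      _ ≤ Real.exp (d * 1) := by
          apply Real.exp_le_exp.2
          calc (m : ℝ) * (d / z) ≤ z * (d / z) := by gcongr
            _ = d * 1 := by field_simp
      _ = Real.exp 1 ^ d := Real.exp_nat_mul _ _
  have h3 : (Real.exp 1 * z / d) ^ d = Real.exp 1 ^ d / (d / z) ^ d := by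
    rw [← div_pow]; congr 1; field_simp
  rw [h3, le_div_iff₀ (by positivity)]
  linarith

section Littlestone

variable {X : Type*}

lemma ShattersTree.mono {m : ℕ} {H H' : Set (X → Bool)} (h : H ⊆ H') (hs : ShattersTree m H) :
    ShattersTree m H' := by
  induction m generalizing H H' with
  | zero => exact Set.Nonempty.mono h hs
  | succ m ih =>
    obtain ⟨x, h1, h2⟩ := hs
    exact ⟨x, ih (fun g hg => ⟨h hg.1, hg.2⟩) h1, ih (fun g hg => ⟨h hg.1, hg.2⟩) h2⟩

lemma not_shattersTree_of_littlestoneDim_le {H : Set (X → Bool)} {d : ℕ}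
    (h : littlestoneDim H ≤ d) : ¬ ShattersTree (d + 1) H := by
  intro hs
  have h1 : ((d + 1 : ℕ) : ℕ∞) ≤ littlestoneDim H :=
    le_iSup₂ (f := fun (m : ℕ) (_ : ShattersTree m H) => (m : ℕ∞)) (d + 1) hs
  have h2 := h1.trans h
  have h3 : d + 1 ≤ d := by exact_mod_cast h2
  omega

/-- The expert that predicts `b x` on a first input `x`, and then follows `E x` with this first
input removed from the history. -/
def prefixExpert (b : X → Bool) (E : X → Expert X) : Expert X
  | [], x => b x
  | x₀ :: l, x => E x₀ l x

lemma predict_prefixExpert_zero (b : X → Bool) (E : X → Expert X) (xs : ℕ → X) :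
    predict (prefixExpert b E) xs 0 = b (xs 0) := rfl

lemma predict_prefixExpert_succ (b : X → Bool) (E : X → Expert X) (xs : ℕ → X) (t : ℕ) :
    predict (prefixExpert b E) xs (t + 1) = predict (E (xs 0)) (fun s => xs (s + 1)) t := by
  simp only [predict, List.range_succ_eq_map, List.map_cons, List.map_map]
  rfl

/-- At every first input `x` one of the two answers leaves a class that shatters no tree of depth
`k`, so the experts split into those that predict the other answer and continue with depth `k + 1`
left, and those that predict this answer and continue with depth `k`: Pascal's rule. -/
lemma exists_adversarialCover_family (T k : ℕ) (H : Set (X → Bool)) (hH : ¬ ShattersTree k H) :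
    ∃ E : Fin (growth T k) → Expert X, ∀ xs : ℕ → X, ∀ h ∈ H,
      ∃ i, ∀ t < T, predict (E i) xs t = h (xs t) := by
  induction T generalizing k H with
  | zero =>
    cases k with
    | zero => exact ⟨fun _ _ _ => true, fun xs h hh => absurd ⟨h, hh⟩ hH⟩
    | succ k => exact ⟨fun _ _ _ => true, fun xs h hh => ⟨⟨0, by simp [growth]⟩, by simp⟩⟩
  | succ T ih =>
    cases k with
    | zero => exact ⟨fun _ _ _ => true, fun xs h hh => absurd ⟨h, hh⟩ hH⟩
    | succ k =>
      have hb : ∀ x, ∃ b : Bool, ¬ ShattersTree k {h ∈ H | h x = !b} := by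
        intro x
        by_contra! hcon
        exact hH ⟨x, by simpa using hcon false, by simpa using hcon true⟩
      choose b hb using hb
      have h1 : ∀ x, ∃ E : Fin (growth T (k + 1)) → Expert X, ∀ xs : ℕ → X,
          ∀ h ∈ {h ∈ H | h x = b x}, ∃ i, ∀ t < T, predict (E i) xs t = h (xs t) :=
        fun x => ih (k + 1) _ fun hs => hH (hs.mono fun g hg => hg.1)
      choose E₁ h1 using h1
      have h2 : ∀ x, ∃ E : Fin (growth T k) → Expert X, ∀ xs : ℕ → X,
          ∀ h ∈ {h ∈ H | h x = !b x}, ∃ i, ∀ t < T, predict (E i) xs t = h (xs t) :=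
        fun x => ih k _ (hb x)
      choose E₂ h2 using h2
      refine ⟨Fin.append (fun i => prefixExpert b fun x => E₁ x i)
        (fun j => prefixExpert (fun x => !b x) fun x => E₂ x j), fun xs h hh => ?_⟩
      by_cases hx : h (xs 0) = b (xs 0)
      · obtain ⟨i, hi⟩ := h1 (xs 0) (fun s => xs (s + 1)) h ⟨hh, hx⟩
        refine ⟨Fin.castAdd _ i, fun t ht => ?_⟩
        rw [Fin.append_left]
        cases t with
        | zero => rw [predict_prefixExpert_zero, hx]
        | succ t => rw [predict_prefixExpert_succ, hi t (by omega)]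
      · have hx : h (xs 0) = !b (xs 0) := by
          cases h' : h (xs 0) <;> cases h'' : b (xs 0) <;> simp_all
        obtain ⟨i, hi⟩ := h2 (xs 0) (fun s => xs (s + 1)) h ⟨hh, hx⟩
        refine ⟨Fin.natAdd _ i, fun t ht => ?_⟩
        rw [Fin.append_right]
        cases t with
        | zero => rw [predict_prefixExpert_zero, hx]
        | succ t => rw [predict_prefixExpert_succ, hi t (by omega)]

lemma exists_adversarialCover {H : Set (X → Bool)} {d T : ℕ} (hd : 1 ≤ d)
    (hH : littlestoneDim H ≤ d) :
    ∃ C : Finset (Expert X), IsAdversarialCover T H C ∧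
      (C.card : ℝ) ≤ adversarialCoverSize d T := by
  classical
  obtain ⟨E, hE⟩ := exists_adversarialCover_family T (d + 1) H
    (not_shattersTree_of_littlestoneDim_le hH)
  refine ⟨Finset.univ.image E, fun xs h hh => ?_, ?_⟩
  · obtain ⟨i, hi⟩ := hE xs h hh
    exact ⟨E i, by simp, hi⟩
  · have h1 : (Finset.univ.image E).card ≤ growth T (d + 1) :=
      Finset.card_image_le.trans (by simp)
    have h2 : ((Finset.univ.image E).card : ℝ) ≤ growth T (d + 1) := by exact_mod_cast h1
    exact h2.trans (growth_le hd (by exact_mod_cast le_max_right _ _)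
      (by exact_mod_cast le_max_left _ _))

end Littlestone

/-! ### Haussler's packing bound and smooth covers -/

section Cube

/-- Every set shattered by `S` has fewer than `k` points. -/
def ShattersLT {X : Type*} (S : Set (X → Bool)) (k : ℕ) : Prop :=
  ∀ A : Finset X, Shatters S A → A.card < k

lemma ShattersLT.eq_empty {X : Type*} {S : Set (X → Bool)} (h : ShattersLT S 0) : S = ∅ := by
  by_contra hne
  obtain ⟨f, hf⟩ := Set.nonempty_iff_ne_empty.2 hne
  exact absurd (h ∅ fun g => ⟨f, hf, by simp⟩) (by simp)

variable {m : ℕ}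

lemma ShattersLT.exists_cons {S : Set (Fin (m + 1) → Bool)} {k : ℕ} (h : ShattersLT S k) :
    ShattersLT {u | ∃ b : Bool, (Fin.cons b u : Fin (m + 1) → Bool) ∈ S} k := by
  intro A hA
  have := h (A.map (Fin.succEmb m)) fun g => by
    obtain ⟨u, ⟨b, hu⟩, hg⟩ := hA fun i => g i.succ
    refine ⟨_, hu, fun a ha => ?_⟩
    obtain ⟨a, ha', rfl⟩ := Finset.mem_map.1 ha
    simpa using hg a ha'
  simpa using this

lemma ShattersLT.forall_cons {S : Set (Fin (m + 1) → Bool)} {k : ℕ} (h : ShattersLT S (k + 1)) :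
    ShattersLT {u | ∀ b : Bool, (Fin.cons b u : Fin (m + 1) → Bool) ∈ S} k := by
  intro A hA
  have := h (insert 0 (A.map (Fin.succEmb m))) fun g => by
    obtain ⟨u, hu, hg⟩ := hA fun i => g i.succ
    refine ⟨_, hu (g 0), fun a ha => ?_⟩
    rcases Finset.mem_insert.1 ha with rfl | ha
    · simp
    · obtain ⟨a, ha', rfl⟩ := Finset.mem_map.1 ha
      simpa using hg a ha'
  rw [Finset.card_insert_of_notMem (by simp [Fin.succ_ne_zero])] at this
  simpa using this

lemma ShattersLT.subset {X : Type*} {S S' : Set (X → Bool)} {k : ℕ} (h : ShattersLT S k)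
    (hS : S' ⊆ S) : ShattersLT S' k := fun A hA => h A fun g => by
  obtain ⟨f, hf, hg⟩ := hA g
  exact ⟨f, hS hf, hg⟩

lemma sum_cube_succ {M : Type*} [AddCommMonoid M] (f : (Fin (m + 1) → Bool) → M) :
    ∑ v, f v = ∑ u : Fin m → Bool, (f (Fin.cons true u) + f (Fin.cons false u)) := by
  rw [← (Fin.consEquiv fun _ => Bool).sum_comp, Fintype.sum_prod_type, Fintype.sum_bool,
    ← Finset.sum_add_distrib]
  rfl

/-- The Sauer–Shelah bound. -/
lemma card_le_growth (k : ℕ) (F : Finset (Fin m → Bool))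
    (h : ShattersLT (F : Set (Fin m → Bool)) k) :
    F.card ≤ growth m k := by
  classical
  induction m generalizing k with
  | zero =>
    cases k with
    | zero => simpa using h.eq_empty
    | succ k =>
      calc F.card ≤ Fintype.card (Fin 0 → Bool) := F.card_le_univ
        _ = growth 0 (k + 1) := by simp [growth]
  | succ m ih =>
    cases k with
    | zero => simpa using h.eq_empty
    | succ k =>
      have h1 := ih (k + 1) (Finset.univ.filter fun u =>
        ∃ b : Bool, (Fin.cons b u : Fin (m + 1) → Bool) ∈ F) (by simpa using h.exists_cons)
      have h2 := ih k (Finset.univ.filter fun u =>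
        ∀ b : Bool, (Fin.cons b u : Fin (m + 1) → Bool) ∈ F)
        (by simpa using h.forall_cons)
      have h3 : F.card = ∑ v, if v ∈ F then 1 else 0 := by simp
      rw [sum_cube_succ] at h3
      rw [h3]
      refine le_trans (le_of_eq ?_) (add_le_add h1 h2)
      rw [Finset.card_filter, Finset.card_filter, ← Finset.sum_add_distrib]
      refine Finset.sum_congr rfl fun u _ => ?_
      by_cases ht : (Fin.cons true u : Fin (m + 1) → Bool) ∈ F <;>
        by_cases hf : (Fin.cons false u : Fin (m + 1) → Bool) ∈ F <;> simp [ht, hf]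

/-- The total weight of the edges in direction `i` of the cube, an edge having the lesser weight of
its two ends. Every edge is counted once from each end. -/
def edgeWeight (w : (Fin m → Bool) → ℕ) (i : Fin m) : ℕ :=
  ∑ v, min (w v) (w (Function.update v i (!v i)))

/-- A weighted form of Haussler's bound for the number of edges that a class spans in the cube.
Splitting the cube into two halves replaces `w` by the pointwise maximum and minimum of its halves;
the edges across the halves weigh as much as the minimum, whose support shatters less. -/
lemma sum_edgeWeight_le (k : ℕ) (w : (Fin m → Bool) → ℕ) (h : ShattersLT {v | w v ≠ 0} k) :
    ∑ i, edgeWeight w i + 2 * ∑ v, w v ≤ 2 * k * ∑ v, w v := by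
  induction m generalizing k with
  | zero =>
    cases k with
    | zero =>
      have h0 : ∀ v, w v = 0 := fun v => by
        by_contra hv
        exact (Set.eq_empty_iff_forall_notMem.1 h.eq_empty v) hv
      simp [h0]
    | succ k => simp; nlinarith
  | succ m ih =>
    cases k with
    | zero =>
      have h0 : ∀ v, w v = 0 := fun v => by
        by_contra hv
        exact (Set.eq_empty_iff_forall_notMem.1 h.eq_empty v) hv
      simp [edgeWeight, h0]
    | succ k =>
      set w₁ : (Fin m → Bool) → ℕ := fun u => max (w (Fin.cons true u)) (w (Fin.cons false u))
        with hw₁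
      set w₂ : (Fin m → Bool) → ℕ := fun u => min (w (Fin.cons true u)) (w (Fin.cons false u))
        with hw₂
      have h1 := ih (k + 1) w₁ (h.exists_cons.subset fun u hu => by
        by_contra hcon
        simp only [Set.mem_ofPred_eq, not_exists, not_not] at hcon
        exact hu (by simp [hw₁, hcon]))
      have h2 := ih k w₂ (h.forall_cons.subset fun u hu b => by
        intro hb
        refine hu ?_
        cases b <;> simp [hw₂, hb])
      have hs : ∑ v, w v = ∑ u, w₁ u + ∑ u, w₂ u := by
        rw [sum_cube_succ, ← Finset.sum_add_distrib]
        exact Finset.sum_congr rfl fun u _ => (max_add_min _ _).symm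
      have e0 : edgeWeight w 0 = 2 * ∑ u, w₂ u := by
        rw [edgeWeight, sum_cube_succ, Finset.mul_sum]
        refine Finset.sum_congr rfl fun u _ => ?_
        simp only [Fin.cons_zero, Fin.update_cons_zero, Bool.not_true, Bool.not_false, hw₂]
        rw [min_comm (w (Fin.cons false u))]
        ring
      have ei : ∀ i : Fin m, edgeWeight w i.succ ≤ edgeWeight w₁ i + edgeWeight w₂ i := by
        intro i
        rw [edgeWeight, sum_cube_succ, edgeWeight, edgeWeight, ← Finset.sum_add_distrib]
        refine Finset.sum_le_sum fun u _ => ?_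
        simp only [Fin.cons_succ, ← Fin.cons_update, hw₁, hw₂]
        omega
      have hsum : ∑ i : Fin m, edgeWeight w i.succ ≤
          ∑ i, edgeWeight w₁ i + ∑ i, edgeWeight w₂ i := by
        rw [← Finset.sum_add_distrib]
        exact Finset.sum_le_sum fun i _ => ei i
      rw [Fin.sum_univ_succ, e0, hs]
      nlinarith

end Cube

section Packing

variable {X ι : Type*} [Fintype ι]

/-- The number of functions with trace `v`, if `τ j` is the trace of the `j`-th function. -/
def traceCount {m : ℕ} (τ : ι → Fin m → Bool) (v : Fin m → Bool) : ℕ :=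
  (Finset.univ.filter fun j => τ j = v).card

lemma sum_traceCount {m : ℕ} (τ : ι → Fin m → Bool) : ∑ v, traceCount τ v = Fintype.card ι := by
  classical
  exact (Finset.card_eq_sum_card_fiberwise (f := τ) (s := Finset.univ) (t := Finset.univ)
    (by simp)).symm

/-- A sample is injective on a set of indices that its traces shatter. -/
lemma ShattersLT.traces {ι : Type*} {q : ι → X → Bool} {k m : ℕ} (h : ShattersLT (Set.range q) k)
    (s : Fin m → X) : ShattersLT (Set.range fun j (i : Fin m) => q j (s i)) k := by
  classical
  intro A hA
  have hinj : Set.InjOn s A := by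
    intro a ha b hb hab
    by_contra hne
    obtain ⟨f, ⟨j, rfl⟩, hf⟩ := hA fun i => decide (i = a)
    have h1 := hf a ha
    have h2 := hf b hb
    simp only [hab, decide_true, Ne.symm hne, decide_false] at h1 h2
    rw [h1] at h2
    cases h2
  rw [← Finset.card_image_of_injOn hinj]
  refine h _ fun g => ?_
  obtain ⟨f, ⟨j, rfl⟩, hf⟩ := hA fun i => g (s i)
  refine ⟨q j, ⟨j, rfl⟩, fun a ha => ?_⟩
  obtain ⟨i, hi, rfl⟩ := Finset.mem_image.1 ha
  exact hf i hi

lemma sum_edgeWeight_traceCount_le {q : ι → X → Bool} {d m : ℕ}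
    (h : ShattersLT (Set.range q) (d + 1)) (s : Fin m → X) :
    ∑ i, edgeWeight (traceCount fun j i => q j (s i)) i ≤ 2 * d * Fintype.card ι := by
  have := sum_edgeWeight_le (d + 1) (traceCount fun j i => q j (s i)) ((h.traces s).subset (by
    intro v hv
    obtain ⟨j, hj⟩ := Finset.card_pos.1 (Nat.pos_of_ne_zero hv)
    exact ⟨j, (Finset.mem_filter.1 hj).2⟩))
  rw [sum_traceCount] at this
  nlinarith

lemma mul_div_add_le_min {a b : ℝ} (ha : 0 ≤ a) (hb : 0 ≤ b) : a * (b / (a + b)) ≤ min a b := by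
  rcases (add_nonneg ha hb).eq_or_lt with h | h
  · have : a = 0 := by linarith
    simp [this, hb]
  · rw [← mul_div_assoc, div_le_iff₀ h]
    rcases le_total a b with hab | hab
    · rw [min_eq_left hab]; nlinarith
    · rw [min_eq_right hab]; nlinarith

open Classical in
/-- The number of functions `q j'` with the same values as `q j` on the sample `u`. -/
def classSize (q : ι → X → Bool) {m : ℕ} (u : Fin m → X) (j : ι) : ℕ :=
  (Finset.univ.filter fun j' => ∀ l, q j' (u l) = q j (u l)).card

lemma classSize_pos (q : ι → X → Bool) {m : ℕ} (u : Fin m → X) (j : ι) : 0 < classSize q u j :=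
  Finset.card_pos.2 ⟨j, by simp⟩

/-- The weight of the edges in the direction of a new sample point `x`, from below by the pairs that
`x` separates inside the classes given by the other sample points. -/
lemma sum_separated_le_edgeWeight (q : ι → X → Bool) {m : ℕ} (i : Fin (m + 1)) (x : X)
    (u : Fin m → X) :
    ∑ j, ((Finset.univ.filter fun j' =>
        (∀ l, q j' (u l) = q j (u l)) ∧ q j' x ≠ q j x).card : ℝ) / classSize q u j ≤
      (edgeWeight (traceCount fun j l => q j ((i.insertNth x u : Fin (m + 1) → X) l)) i : ℝ) := by
  classical
  set τ : ι → Fin (m + 1) → Bool := fun j l => q j ((i.insertNth x u : Fin (m + 1) → X) l) with hτ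
  have hflip : ∀ j, (Finset.univ.filter fun j' =>
      (∀ l, q j' (u l) = q j (u l)) ∧ q j' x ≠ q j x) =
      Finset.univ.filter fun j' => τ j' = Function.update (τ j) i (!τ j i) := by
    intro j
    ext j'
    simp only [Finset.mem_filter, Finset.mem_univ, true_and, funext_iff, hτ,
      Fin.forall_iff_succAbove i, Fin.insertNth_apply_same, Fin.insertNth_apply_succAbove,
      Function.update_self, ne_eq, Fin.succAbove_ne, not_false_eq_true, Function.update_of_ne]
    rw [and_comm]
    cases q j x <;> cases q j' x <;> simp
  have hsame : ∀ j, (Finset.univ.filter fun j' =>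
      (∀ l, q j' (u l) = q j (u l)) ∧ q j' x = q j x) =
      Finset.univ.filter fun j' => τ j' = τ j := by
    intro j
    ext j'
    simp only [Finset.mem_filter, Finset.mem_univ, true_and, funext_iff, hτ,
      Fin.forall_iff_succAbove i, Fin.insertNth_apply_same, Fin.insertNth_apply_succAbove]
    rw [and_comm]
  have hsize : ∀ j, classSize q u j =
      traceCount τ (τ j) + traceCount τ (Function.update (τ j) i (!τ j i)) := by
    intro j
    rw [traceCount, traceCount, ← hflip, ← hsame, classSize,
      ← Finset.card_filter_add_card_filter_not (s := Finset.univ.filter fun j' =>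
        ∀ l, q j' (u l) = q j (u l)) (fun j' => q j' x = q j x),
      Finset.filter_filter, Finset.filter_filter]
  rw [edgeWeight, Nat.cast_sum, ← Finset.sum_fiberwise Finset.univ τ]
  refine Finset.sum_le_sum fun v _ => ?_
  have : ∀ j ∈ Finset.univ.filter fun j => τ j = v, ((Finset.univ.filter fun j' =>
      (∀ l, q j' (u l) = q j (u l)) ∧ q j' x ≠ q j x).card : ℝ) / classSize q u j =
      (traceCount τ (Function.update v i (!v i)) : ℝ) /
        (traceCount τ v + traceCount τ (Function.update v i (!v i))) := by
    intro j hj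
    have hj : τ j = v := (Finset.mem_filter.1 hj).2
    rw [hflip, hsize, hj, Nat.cast_add]
    rfl
  rw [Finset.sum_congr rfl this, Finset.sum_const, nsmul_eq_mul, Nat.cast_min]
  exact mul_div_add_le_min (Nat.cast_nonneg _) (Nat.cast_nonneg _)

/-- There are at most `growth m k` classes on `m` sample points. -/
lemma sum_inv_classSize_le {q : ι → X → Bool} {k m : ℕ} (h : ShattersLT (Set.range q) k)
    (u : Fin m → X) : ∑ j, (1 : ℝ) / classSize q u j ≤ growth m k := by
  classical
  set τ : ι → Fin m → Bool := fun j l => q j (u l) with hτ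
  have h1 : (Finset.univ.image τ).card ≤ growth m k :=
    card_le_growth k _ (by simpa using h.traces u)
  have h2 : ∑ j, (1 : ℝ) / classSize q u j = (Finset.univ.image τ).card := by
    rw [← Finset.sum_fiberwise_of_maps_to (g := τ) (t := Finset.univ.image τ) (by simp),
      Finset.card_eq_sum_ones, Nat.cast_sum]
    refine Finset.sum_congr rfl fun v hv => ?_
    obtain ⟨j₀, -, hj₀⟩ := Finset.mem_image.1 hv
    have : ∀ j ∈ Finset.univ.filter fun j => τ j = v, (1 : ℝ) / classSize q u j =
        1 / (Finset.univ.filter fun j => τ j = v).card := by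
      intro j hj
      have hj : τ j = v := (Finset.mem_filter.1 hj).2
      rw [classSize]
      congr 4
      ext j'
      rw [← hj, funext_iff]
    rw [Finset.sum_congr rfl this, Finset.sum_const, nsmul_eq_mul, mul_one_div, div_self]
    · simp
    · exact_mod_cast (Finset.card_pos.2 ⟨j₀, by simp [hj₀]⟩).ne'
  rw [h2]
  exact_mod_cast h1

variable [MeasurableSpace X]

lemma measurable_traces {ι : Type*} {q : ι → X → Bool} (hq : ∀ j, Measurable (q j)) (m : ℕ) :
    Measurable fun s : Fin m → X => fun j l => q j (s l) := by
  refine measurable_pi_lambda _ fun j => measurable_pi_lambda _ fun l => ?_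
  exact (hq j).comp (measurable_pi_apply l)

lemma integrable_edgeWeight {q : ι → X → Bool} (hq : ∀ j, Measurable (q j)) {m : ℕ} (i : Fin m)
    (U : Measure (Fin m → X)) [IsFiniteMeasure U] :
    Integrable (fun s : Fin m → X => (edgeWeight (traceCount fun j l => q j (s l)) i : ℝ)) U :=
  Integrable.comp_measurable
    (g := fun τ : ι → Fin m → Bool => (edgeWeight (traceCount τ) i : ℝ)) Integrable.of_finite
    (measurable_traces hq m)

lemma le_integral_edgeWeight (U : Measure X) [IsProbabilityMeasure U] {q : ι → X → Bool}
    (hq : ∀ j, Measurable (q j)) {ε : ℝ}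
    (hsep : ∀ j j', j ≠ j' → ε ≤ U.real {x | q j x ≠ q j' x}) {k m : ℕ}
    (h : ShattersLT (Set.range q) k) (hε : 0 ≤ ε) (i : Fin (m + 1)) :
    ε * (Fintype.card ι - growth m k) ≤
      ∫ s, (edgeWeight (traceCount fun j l => q j (s l)) i : ℝ) ∂(Measure.pi fun _ => U) := by
  classical
  set f : (Fin (m + 1) → X) → ℝ := fun s => edgeWeight (traceCount fun j l => q j (s l)) i with hf
  have hmp := (measurePreserving_piFinSuccAbove (fun _ : Fin (m + 1) => U) i).symm
  have hint : Integrable (fun p : X × (Fin m → X) => f (i.insertNth p.1 p.2))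
      (U.prod (Measure.pi fun _ => U)) := by
    have := hmp.integrable_comp_of_integrable (integrable_edgeWeight hq i _)
    exact this
  have hcomp : ∫ s, f s ∂(Measure.pi fun _ => U) =
      ∫ u, ∫ x, f (i.insertNth x u) ∂U ∂(Measure.pi fun _ => U) := by
    rw [← integral_prod_symm _ hint, ← hmp.integral_comp']
    rfl
  rw [hcomp]
  have hinner : ∀ᵐ u ∂(Measure.pi fun _ : Fin m => U),
      ε * (Fintype.card ι - growth m k) ≤ ∫ x, f (i.insertNth x u) ∂U := by
    filter_upwards [hint.prod_left_ae] with u hu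
    have hmeas : ∀ j j', MeasurableSet {x | q j' x ≠ q j x} := fun j j' =>
      (measurableSet_eq_fun (hq j') (hq j)).compl
    have hintI : ∀ j j', Integrable (fun x =>
        if q j' x ≠ q j x then (1 : ℝ) else 0) U := fun j j' => by
      refine ((integrable_const (1 : ℝ) (μ := U)).indicator (hmeas j j')).congr
        (ae_of_all _ fun x => ?_)
      by_cases hx : q j' x = q j x <;> simp [Set.indicator, hx]
    have hval : ∀ j j', ∫ x, (if q j' x ≠ q j x then (1 : ℝ) else 0) ∂U =
        U.real {x | q j' x ≠ q j x} := fun j j' => by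
      rw [← integral_indicator_one (hmeas j j')]
      refine integral_congr_ae (ae_of_all _ fun x => ?_)
      by_cases hx : q j' x = q j x <;> simp [Set.indicator, hx]
    have hterm : ∀ x, ∑ j, ((Finset.univ.filter fun j' =>
        (∀ l, q j' (u l) = q j (u l)) ∧ q j' x ≠ q j x).card : ℝ) / classSize q u j =
        ∑ j, (∑ j' ∈ Finset.univ.filter fun j' => ∀ l, q j' (u l) = q j (u l),
          if q j' x ≠ q j x then (1 : ℝ) else 0) / classSize q u j := by
      intro x
      refine Finset.sum_congr rfl fun j _ => ?_
      rw [← Finset.filter_filter, Finset.card_filter, Nat.cast_sum]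
      simp only [Nat.cast_ite, Nat.cast_one, Nat.cast_zero]
    calc ε * (Fintype.card ι - growth m k)
        ≤ ε * (Fintype.card ι - ∑ j, (1 : ℝ) / classSize q u j) := by
          gcongr; exact sum_inv_classSize_le h u
      _ = ∑ j, ((classSize q u j - 1 : ℝ) * ε) / classSize q u j := by
          rw [← Finset.card_univ, Finset.card_eq_sum_ones, Nat.cast_sum, ← Finset.sum_sub_distrib,
            Finset.mul_sum]
          refine Finset.sum_congr rfl fun j _ => ?_
          have : (classSize q u j : ℝ) ≠ 0 := by exact_mod_cast (classSize_pos q u j).ne'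
          field_simp
          push_cast
          ring
      _ ≤ ∑ j, (∑ j' ∈ Finset.univ.filter fun j' => ∀ l, q j' (u l) = q j (u l),
          U.real {x | q j' x ≠ q j x}) / classSize q u j := by
          refine Finset.sum_le_sum fun j _ => ?_
          gcongr
          have hj : j ∈ Finset.univ.filter fun j' => ∀ l, q j' (u l) = q j (u l) := by simp
          rw [← Finset.add_sum_erase _ _ hj]
          have hcard : ((classSize q u j - 1 : ℝ)) =
              ((Finset.univ.filter fun j' => ∀ l, q j' (u l) = q j (u l)).erase j).card := by
            rw [Finset.card_erase_of_mem hj, Nat.cast_pred (Finset.card_pos.2 ⟨j, hj⟩)]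
            simp only [classSize]
          rw [hcard, ← nsmul_eq_mul]
          have := Finset.card_nsmul_le_sum
            ((Finset.univ.filter fun j' => ∀ l, q j' (u l) = q j (u l)).erase j)
            (fun j' => U.real {x | q j' x ≠ q j x}) ε
            (fun j' hj' => hsep j' j (Finset.ne_of_mem_erase hj'))
          have h0 : 0 ≤ U.real {x | q j x ≠ q j x} := measureReal_nonneg
          linarith
      _ = ∫ x, ∑ j, (∑ j' ∈ Finset.univ.filter fun j' => ∀ l, q j' (u l) = q j (u l),
          if q j' x ≠ q j x then (1 : ℝ) else 0) / classSize q u j ∂U := by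
          rw [integral_finsetSum _ fun j _ =>
            (integrable_finsetSum _ fun j' _ => hintI j j').div_const _]
          refine Finset.sum_congr rfl fun j _ => ?_
          rw [integral_div, integral_finsetSum _ fun j' _ => hintI j j']
          simp only [hval]
      _ ≤ ∫ x, f (i.insertNth x u) ∂U := by
          refine integral_mono (integrable_finsetSum _ fun j _ =>
            (integrable_finsetSum _ fun j' _ => hintI j j').div_const _) hu fun x => ?_
          simp only [← hterm x]
          convert sum_separated_le_edgeWeight q i x u
  calc ε * (Fintype.card ι - growth m k)
      = ∫ _, ε * (Fintype.card ι - growth m k) ∂(Measure.pi fun _ : Fin m => U) := by simp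
    _ ≤ _ := integral_mono_ae (integrable_const _) hint.integral_prod_right hinner

/-- Haussler's packing bound. On a random sample of about `4 d / ε` points, the edge weight of the
traces is at most `2 d` per function by `sum_edgeWeight_le`, while `le_integral_edgeWeight` makes it
large on average unless the functions are at most twice as many as their traces. -/
lemma card_le_of_separated (U : Measure X) [IsProbabilityMeasure U] {q : ι → X → Bool}
    (hq : ∀ j, Measurable (q j)) {ε : ℝ} (hε : 0 < ε) (hε1 : ε ≤ 1)
    (hsep : ∀ j j', j ≠ j' → ε ≤ U.real {x | q j x ≠ q j' x}) {d : ℕ} (hd : 1 ≤ d)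
    (h : ShattersLT (Set.range q) (d + 1)) :
    (Fintype.card ι : ℝ) ≤ smoothCoverSize d ε := by
  have hd0 : (0 : ℝ) < d := by exact_mod_cast hd
  -- `m + 1` sample points, so that `m + 1 > 4 d / ε`, while the traces on `m ≤ 4 d / ε` of them
  -- are counted by the Sauer–Shelah bound
  set m := ⌊4 * d / ε⌋₊ with hm
  have hm1 : (m : ℝ) ≤ 4 * d / ε := Nat.floor_le (by positivity)
  have hm2 : 4 * d / ε < m + 1 := Nat.lt_floor_add_one _
  have hup : ∑ i : Fin (m + 1), ∫ s, (edgeWeight (traceCount fun j l => q j (s l)) i : ℝ)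
      ∂(Measure.pi fun _ => U) ≤ 2 * d * Fintype.card ι := by
    rw [← integral_finsetSum _ fun i _ => integrable_edgeWeight hq i _]
    calc _ ≤ ∫ _, (2 * d * Fintype.card ι : ℝ) ∂(Measure.pi fun _ : Fin (m + 1) => U) := by
          refine integral_mono (integrable_finsetSum _ fun i _ => integrable_edgeWeight hq i _)
            (integrable_const _) fun s => ?_
          have := sum_edgeWeight_traceCount_le h s
          simp only
          exact_mod_cast this
      _ = _ := by simp
  have hlow : (m + 1 : ℝ) * (ε * (Fintype.card ι - growth m (d + 1))) ≤
      2 * d * Fintype.card ι := by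
    refine le_trans ?_ hup
    have := Finset.card_nsmul_le_sum (Finset.univ : Finset (Fin (m + 1))) _ _
      fun i _ => le_integral_edgeWeight U hq hsep h hε.le i
    simpa using this
  have hg : (growth m (d + 1) : ℝ) ≤ (4 * Real.exp 1 / ε) ^ d := by
    have hz : (d : ℝ) ≤ 4 * d / ε := by
      rw [le_div_iff₀ hε]; nlinarith
    refine (growth_le hd hz hm1).trans (le_of_eq ?_)
    congr 1
    field_simp
  have hM : (Fintype.card ι : ℝ) ≤ 2 * growth m (d + 1) := by
    by_contra! hcon
    have h0 : (0 : ℝ) ≤ growth m (d + 1) := Nat.cast_nonneg _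
    have h1 : 4 * d < (m + 1) * ε := (div_lt_iff₀ hε).1 hm2
    nlinarith
  have he : Real.exp 1 < 2.7182818286 := Real.exp_one_lt_d9
  calc (Fintype.card ι : ℝ) ≤ 2 * (4 * Real.exp 1 / ε) ^ d := by linarith
    _ ≤ 2 ^ d * (4 * Real.exp 1 / ε) ^ d := by
        gcongr
        exact le_self_pow₀ (by norm_num) (by omega)
    _ = (8 * Real.exp 1 / ε) ^ d := by rw [← mul_pow]; ring
    _ ≤ (41 / ε) ^ d := by gcongr; linarith

lemma shattersLT_of_vcDim_le {X : Type*} {H : Set (X → Bool)} {d : ℕ} (h : vcDim H ≤ d) :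
    ShattersLT H (d + 1) := by
  intro A hA
  have h1 : (A.card : ℕ∞) ≤ vcDim H :=
    le_iSup₂ (f := fun (A : Finset X) (_ : Shatters H A) => (A.card : ℕ∞)) A hA
  have h2 : A.card ≤ d := by exact_mod_cast h1.trans h
  omega

/-- A maximal packing is a cover. -/
lemma exists_smoothCover (U : Measure X) [IsProbabilityMeasure U] {H : Set (X → Bool)}
    (hH : ∀ h ∈ H, Measurable h) {d : ℕ} (hd : 1 ≤ d) (hvc : vcDim H ≤ d) {ε : ℝ} (hε : 0 < ε)
    (hε1 : ε ≤ 1) :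
    ∃ C : Finset (Expert X), IsSmoothCover U ε H C ∧ (C.card : ℝ) ≤ smoothCoverSize d ε := by
  classical
  set IsPacking : Finset (X → Bool) → Prop := fun Q => (Q : Set (X → Bool)) ⊆ H ∧
    ∀ f ∈ Q, ∀ g ∈ Q, f ≠ g → ε ≤ U.real {x | f x ≠ g x} with hP
  have hbound : ∀ Q, IsPacking Q → (Q.card : ℝ) ≤ smoothCoverSize d ε := by
    intro Q hQ
    have := card_le_of_separated U (q := fun j : Q => (j : X → Bool))
      (fun j => hH _ (hQ.1 j.2)) hε hε1
      (fun j j' hj => hQ.2 _ j.2 _ j'.2 fun h => hj (Subtype.ext h)) hd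
      ((shattersLT_of_vcDim_le hvc).subset (by rintro _ ⟨j, rfl⟩; exact hQ.1 j.2))
    simpa using this
  obtain ⟨Q, hQ, hmax⟩ : ∃ Q, IsPacking Q ∧ ∀ Q', IsPacking Q' → Q'.card ≤ Q.card := by
    obtain ⟨Q, hQ, hQc⟩ := Nat.findGreatest_spec (P := fun n => ∃ Q, IsPacking Q ∧ Q.card = n)
      (n := ⌊smoothCoverSize d ε⌋₊) (Nat.zero_le _) ⟨∅, by simp [hP], rfl⟩
    refine ⟨Q, hQ, fun Q' hQ' => hQc ▸ Nat.le_findGreatest ?_ ⟨Q', hQ', rfl⟩⟩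
    exact Nat.le_floor (hbound Q' hQ')
  refine ⟨Q.image fun g _ x => g x, ⟨?_, fun h hh => ?_⟩, ?_⟩
  · intro e he
    obtain ⟨g, hg, rfl⟩ := Finset.mem_image.1 he
    exact ⟨g, hH g (hQ.1 hg), rfl⟩
  · by_contra! hcon
    have hfar : ∀ g ∈ Q, ε ≤ U.real {x | g x ≠ h x} := fun g hg => by
      have h1 := hcon _ (Finset.mem_image_of_mem (fun g (_ : List X) x => g x) hg)
      exact (ENNReal.ofReal_le_iff_le_toReal (measure_ne_top _ _)).1 h1.le
    have hnot : h ∉ Q := fun hmem => by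
      have := hfar h hmem
      simp at this
      linarith
    have := hmax (insert h Q) ⟨by
      rw [Finset.coe_insert]
      exact Set.insert_subset hh hQ.1, by
      intro f hf g hg hfg
      rcases Finset.mem_insert.1 hf with rfl | hf' <;>
        rcases Finset.mem_insert.1 hg with rfl | hg'
      · exact absurd rfl hfg
      · simpa only [ne_comm] using hfar g hg'
      · exact hfar f hf'
      · exact hQ.2 f hf' g hg' hfg⟩
    rw [Finset.card_insert_of_notMem hnot] at this
    omega
  · refine le_trans ?_ (hbound Q hQ)
    exact_mod_cast Finset.card_image_le

end Packing

/-! ### The potential argument for Hedge -/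

section Hedge

variable {X : Type*} {T : ℕ} {ε : ℝ} {C : Finset (Expert X)} {f : X → Bool} {xs : ℕ → X}
  {coin : ℕ → Bool} {t : ℕ} {e : Expert X}

lemma loss_eq_zero_or_one (f : X → Bool) (xs : ℕ → X) (t : ℕ) (e : Expert X) :
    loss f xs t e = 0 ∨ loss f xs t e = 1 := by
  unfold loss; split_ifs <;> simp

lemma loss_nonneg (f : X → Bool) (xs : ℕ → X) (t : ℕ) (e : Expert X) : 0 ≤ loss f xs t e := by
  rcases loss_eq_zero_or_one f xs t e with h | h <;> simp [h]

lemma loss_le_one (f : X → Bool) (xs : ℕ → X) (t : ℕ) (e : Expert X) : loss f xs t e ≤ 1 := by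
  rcases loss_eq_zero_or_one f xs t e with h | h <;> simp [h]

lemma bestLoss_le (he : e ∈ C) : bestLoss C f xs t ≤ loss f xs t e :=
  csInf_le ⟨0, by rintro _ ⟨e, -, rfl⟩; exact loss_nonneg f xs t e⟩ ⟨e, he, rfl⟩

lemma exists_loss_eq_bestLoss (hC : C.Nonempty) : ∃ e ∈ C, loss f xs t e = bestLoss C f xs t := by
  have := Set.Nonempty.csInf_mem (s := (fun e => loss f xs t e) '' (C : Set (Expert X)))
    (hC.to_set.image _) (C.finite_toSet.image _)
  exact this

/-- The excess `ℓ - ℓ*` of the loss of `e` over the least loss. -/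
noncomputable def gap (C : Finset (Expert X)) (f : X → Bool) (xs : ℕ → X) (t : ℕ) (e : Expert X) :
    ℝ :=
  loss f xs t e - bestLoss C f xs t

lemma gap_eq_zero_or_one (he : e ∈ C) : gap C f xs t e = 0 ∨ gap C f xs t e = 1 := by
  obtain ⟨e', -, h'⟩ := exists_loss_eq_bestLoss (f := f) (xs := xs) (t := t) ⟨e, he⟩
  have h := bestLoss_le (f := f) (xs := xs) (t := t) he
  rw [gap]
  rcases loss_eq_zero_or_one f xs t e with h1 | h1 <;>
    rcases loss_eq_zero_or_one f xs t e' with h2 | h2 <;>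
    first | (left; linarith) | (right; linarith)

lemma gap_nonneg (he : e ∈ C) : 0 ≤ gap C f xs t e := by
  rcases gap_eq_zero_or_one (f := f) (xs := xs) (t := t) he with h | h <;> simp [h]

lemma gap_le_one (he : e ∈ C) : gap C f xs t e ≤ 1 := by
  rcases gap_eq_zero_or_one (f := f) (xs := xs) (t := t) he with h | h <;> simp [h]

lemma bestLoss_nonneg (hC : C.Nonempty) : 0 ≤ bestLoss C f xs t := by
  obtain ⟨e, -, h⟩ := exists_loss_eq_bestLoss (f := f) (xs := xs) (t := t) hC
  exact h ▸ loss_nonneg f xs t e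

lemma bestLoss_le_one (hC : C.Nonempty) : bestLoss C f xs t ≤ 1 := by
  obtain ⟨e, -, h⟩ := exists_loss_eq_bestLoss (f := f) (xs := xs) (t := t) hC
  exact h ▸ loss_le_one f xs t e

lemma gap_le_loss (he : e ∈ C) : gap C f xs t e ≤ loss f xs t e :=
  sub_le_self _ (bestLoss_nonneg ⟨e, he⟩)

lemma weight_pos (T : ℕ) (ε : ℝ) (C : Finset (Expert X)) (f : X → Bool) (xs : ℕ → X)
    (coin : ℕ → Bool) (t : ℕ) (e : Expert X) : 0 < weight T ε C f xs coin t e := by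
  induction t with
  | zero => exact one_pos
  | succ t ih => unfold weight; split_ifs <;> positivity

lemma hedgeProb_nonneg : 0 ≤ hedgeProb T ε C f xs coin t e :=
  div_nonneg (weight_pos _ _ _ _ _ _ _ _).le
    (Finset.sum_nonneg fun _ _ => (weight_pos _ _ _ _ _ _ _ _).le)

lemma sum_weight_pos (hC : C.Nonempty) : 0 < ∑ e ∈ C, weight T ε C f xs coin t e :=
  Finset.sum_pos (fun _ _ => weight_pos _ _ _ _ _ _ _ _) hC

lemma sum_hedgeProb (hC : C.Nonempty) : ∑ e ∈ C, hedgeProb T ε C f xs coin t e = 1 := by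
  simp only [hedgeProb]
  rw [← Finset.sum_div, div_self (sum_weight_pos hC).ne']

lemma hedgeProb_le_one (he : e ∈ C) : hedgeProb T ε C f xs coin t e ≤ 1 :=
  (Finset.single_le_sum (f := hedgeProb T ε C f xs coin t) (fun _ _ => hedgeProb_nonneg) he).trans
    (sum_hedgeProb ⟨e, he⟩).le

/-- The mean excess loss of the Hedge distribution at time `t`. -/
noncomputable def hedgeGap (T : ℕ) (ε : ℝ) (C : Finset (Expert X)) (f : X → Bool) (xs : ℕ → X)
    (coin : ℕ → Bool) (t : ℕ) : ℝ :=
  ∑ e ∈ C, hedgeProb T ε C f xs coin t e * gap C f xs t e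

lemma hedgeGap_nonneg : 0 ≤ hedgeGap T ε C f xs coin t :=
  Finset.sum_nonneg fun _ he => mul_nonneg hedgeProb_nonneg (gap_nonneg he)

lemma hedgeGap_le_one (hC : C.Nonempty) : hedgeGap T ε C f xs coin t ≤ 1 := by
  rw [← sum_hedgeProb (T := T) (ε := ε) (f := f) (xs := xs) (coin := coin) (t := t) hC]
  exact Finset.sum_le_sum fun e he => mul_le_of_le_one_right hedgeProb_nonneg (gap_le_one he)

/-- The factor by which one query multiplies the weight of an expert with excess loss `1` is
`exp (-rate)`. -/
noncomputable def rate (T : ℕ) (ε : ℝ) (N : ℕ) : ℝ := learningRate T ε N / queryProb T ε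

/-- As excess losses are `0` or `1`, the factor `exp (-rate * gap)` is linear in the gap. -/
lemma weight_succ_of_coin (he : e ∈ C) (hc : coin t = true) :
    weight T ε C f xs coin (t + 1) e = weight T ε C f xs coin t e *
      (1 - gap C f xs t e * (1 - Real.exp (-rate T ε C.card))) := by
  have h1 : learningRate T ε C.card * ((loss f xs t e - bestLoss C f xs t) / queryProb T ε) =
      rate T ε C.card * gap C f xs t e := by
    rw [rate, gap]; ring
  rw [weight, if_pos hc, h1]
  rcases gap_eq_zero_or_one (f := f) (xs := xs) (t := t) he with h | h <;> rw [h] <;> simp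

lemma weight_succ_of_not_coin (hc : coin t = false) :
    weight T ε C f xs coin (t + 1) e = weight T ε C f xs coin t e := by
  rw [weight, if_neg (by simp [hc])]

lemma log_weight (he : e ∈ C) (n : ℕ) :
    Real.log (weight T ε C f xs coin n e) =
      -(rate T ε C.card * ∑ s ∈ Finset.range n, if coin s = true then gap C f xs s e else 0) := by
  induction n with
  | zero => simp [weight]
  | succ n ih =>
    rw [Finset.sum_range_succ]
    cases hc : coin n with
    | false => rw [weight_succ_of_not_coin hc, ih]; simp
    | true =>
      rw [weight_succ_of_coin he hc]
      rcases gap_eq_zero_or_one (f := f) (xs := xs) (t := n) he with h | h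
      · rw [h]; simp [ih]
      · rw [h, one_mul, sub_sub_cancel, Real.log_mul (weight_pos _ _ _ _ _ _ _ _).ne'
          (Real.exp_pos _).ne', ih, Real.log_exp, if_pos rfl]
        ring

lemma sum_weight_succ_of_coin (hC : C.Nonempty) (hc : coin t = true) :
    ∑ e ∈ C, weight T ε C f xs coin (t + 1) e = (∑ e ∈ C, weight T ε C f xs coin t e) *
      (1 - hedgeGap T ε C f xs coin t * (1 - Real.exp (-rate T ε C.card))) := by
  have hW := (sum_weight_pos (T := T) (ε := ε) (f := f) (xs := xs) (coin := coin) (t := t) hC).ne'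
  have hs : (∑ e ∈ C, weight T ε C f xs coin t e) * hedgeGap T ε C f xs coin t =
      ∑ e ∈ C, weight T ε C f xs coin t e * gap C f xs t e := by
    rw [hedgeGap, Finset.mul_sum]
    refine Finset.sum_congr rfl fun e _ => ?_
    rw [hedgeProb]
    field_simp
  rw [mul_sub, mul_one, ← mul_assoc, hs, Finset.sum_mul, ← Finset.sum_sub_distrib]
  refine Finset.sum_congr rfl fun e he => ?_
  rw [weight_succ_of_coin he hc]
  ring

lemma log_sum_weight_le (hC : C.Nonempty) (n : ℕ) :
    Real.log (∑ e ∈ C, weight T ε C f xs coin n e) ≤ Real.log C.card -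
      (∑ s ∈ Finset.range n, if coin s = true then hedgeGap T ε C f xs coin s else 0) *
        (1 - Real.exp (-rate T ε C.card)) := by
  induction n with
  | zero => simp [weight]
  | succ n ih =>
    rw [Finset.sum_range_succ]
    cases hc : coin n with
    | false =>
      simp only [weight_succ_of_not_coin hc]
      simpa using ih
    | true =>
      have h0 : 0 < ∑ e ∈ C, weight T ε C f xs coin (n + 1) e := sum_weight_pos hC
      have hW : 0 < ∑ e ∈ C, weight T ε C f xs coin n e := sum_weight_pos hC
      rw [sum_weight_succ_of_coin hC hc] at h0 ⊢
      have h1 := (pos_iff_pos_of_mul_pos h0).1 hW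
      rw [Real.log_mul hW.ne' h1.ne', if_pos rfl]
      have h2 := Real.log_le_sub_one_of_pos h1
      linarith

/-- The regret inequality of Hedge on one realization. -/
lemma sum_hedgeGap_mul_le (he : e ∈ C) (n : ℕ) :
    (∑ s ∈ Finset.range n, if coin s = true then hedgeGap T ε C f xs coin s else 0) *
        (1 - Real.exp (-rate T ε C.card)) ≤ Real.log C.card +
      rate T ε C.card * ∑ s ∈ Finset.range n, if coin s = true then gap C f xs s e else 0 := by
  have h1 := log_sum_weight_le (T := T) (ε := ε) (f := f) (xs := xs) (coin := coin) ⟨e, he⟩ n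
  have h2 := log_weight (T := T) (ε := ε) (f := f) (xs := xs) (coin := coin) he n
  have h3 : Real.log (weight T ε C f xs coin n e) ≤
      Real.log (∑ e ∈ C, weight T ε C f xs coin n e) :=
    Real.log_le_log (weight_pos _ _ _ _ _ _ _ _)
      (Finset.single_le_sum (f := weight T ε C f xs coin n)
        (fun _ _ => (weight_pos _ _ _ _ _ _ _ _).le) he)
  linarith

/-- The consequence of the regret inequality for the chosen learning rate. If the rate is at most
`1`, the bound `η ≥ p² / √2` is used; otherwise `log N > 2 p T` and the trivial bound `S ≤ T` is
good enough. -/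
lemma le_of_rate_inequality {T N : ℕ} {ε S G : ℝ} (hT : 0 < T) (hp0 : 0 < queryProb T ε)
    (hp1 : queryProb T ε ≤ 1) (hS0 : 0 ≤ S) (hST : S ≤ T) (hG : 0 ≤ G)
    (h : queryProb T ε * (1 - Real.exp (-rate T ε N)) * S ≤
      Real.log N + rate T ε N * (queryProb T ε * G)) :
    S ≤ 3 * (Real.log N / queryProb T ε ^ 2) + 2 * G := by
  have hlog : 0 ≤ Real.log N := Real.log_natCast_nonneg N
  have hT0 : (0 : ℝ) < T := by exact_mod_cast hT
  set p := queryProb T ε with hp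
  set η := learningRate T ε N with hη
  have hu : rate T ε N = η / p := rfl
  have h2 : (0 : ℝ) < Real.sqrt 2 := by positivity
  have hηlow : p ^ 2 / Real.sqrt 2 ≤ η := le_max_right _ _
  have hη0 : 0 < η := lt_of_lt_of_le (by positivity) hηlow
  have hs2 : Real.sqrt 2 ≤ 3 / 2 := by
    rw [Real.sqrt_le_left (by norm_num)]; norm_num
  have hs1 : 1 ≤ Real.sqrt 2 := by
    rw [Real.one_le_sqrt]; norm_num
  have hup : η / p * (p * G) = η * G := by field_simp
  rw [hu, hup] at h
  rcases le_or_gt (η / p) 1 with hle | hgt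
  · have hu0 : 0 < η / p := by positivity
    have hexp : Real.exp (-(η / p)) ≤ 1 - η / p / 2 := by
      rw [Real.exp_neg, inv_le_iff_one_le_mul₀ (Real.exp_pos _)]
      have := Real.add_one_le_exp (η / p)
      have h3 : 0 < 1 - η / p / 2 := by linarith
      nlinarith
    have h4 : η / 2 * S ≤ p * (1 - Real.exp (-(η / p))) * S := by
      have : η / 2 = p * (η / p / 2) := by field_simp
      rw [this]
      gcongr
      linarith
    have h5 : S ≤ 2 * (Real.log N / η) + 2 * G := by
      have h6 : η * S ≤ η * (2 * (Real.log N / η) + 2 * G) := by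
        have : η * (2 * (Real.log N / η) + 2 * G) = 2 * (Real.log N + η * G) := by field_simp
        rw [this]; linarith
      exact le_of_mul_le_mul_left h6 hη0
    have h7 : Real.log N / η ≤ 3 / 2 * (Real.log N / p ^ 2) := by
      rw [div_le_iff₀ hη0]
      calc Real.log N = Real.log N / p ^ 2 * p ^ 2 := by field_simp
        _ ≤ Real.log N / p ^ 2 * (3 / 2 * η) := by
            gcongr
            rw [div_le_iff₀ h2] at hηlow
            nlinarith
        _ = 3 / 2 * (Real.log N / p ^ 2) * η := by ring
    linarith
  · rw [lt_div_iff₀ hp0, one_mul] at hgt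
    have hsq : p < Real.sqrt (p * Real.log N / (2 * T)) := by
      rcases lt_max_iff.1 (show p < max _ _ from hgt) with h3 | h3
      · exact h3
      · exfalso
        rw [lt_div_iff₀ h2] at h3
        nlinarith
    rw [Real.lt_sqrt hp0.le, lt_div_iff₀ (by positivity)] at hsq
    have h8 : p * (2 * T) < Real.log N := by nlinarith
    have h9 : (T : ℝ) ≤ Real.log N / p ^ 2 := by
      rw [le_div_iff₀ (by positivity)]
      nlinarith
    have : 0 ≤ Real.log N / p ^ 2 := by positivity
    linarith

end Hedge

/-! ### Expected mistakes of one copy -/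

section Execution

variable {Ω X Y : Type*} [MetricSpace X] [MeasurableSpace X] [Fintype Y] [mΩ : MeasurableSpace Ω]
  {P : Measure Ω} {I : Interaction Ω X Y} {mentor : X → Y} {T : ℕ} {ε r : ℝ}
  {cover : Y → Finset (Expert X)} {t : ℕ} {y : Y} {e : Expert X}

lemma measurable_ite_const {Ω : Type*} {m : MeasurableSpace Ω} {p : Ω → Prop} [DecidablePred p]
    (hp : MeasurableSet[m] {ω | p ω}) (a b : ℝ) :
    Measurable[m] fun ω => if p ω then a else b :=
  Measurable.ite hp measurable_const measurable_const

section Mistake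

variable {Ω X Y : Type*} (I : Interaction Ω X Y) (mentor : X → Y) (t : ℕ) (y : Y) (ω : Ω)

/-- The loss of the expert that copy `y` follows at time `t`: it is `1` if the proposal of the copy
is wrong, and `0` otherwise. -/
noncomputable def Interaction.mistake : ℝ :=
  loss (indicatorPolicy mentor y) (I.inputs ω) t (I.policy t ω y)

lemma Interaction.mistake_nonneg : 0 ≤ I.mistake mentor t y ω := loss_nonneg _ _ _ _

lemma Interaction.mistake_le_one : I.mistake mentor t y ω ≤ 1 := loss_le_one _ _ _ _

end Mistake

namespace Interaction.IsExecution

lemma present_le (h : I.IsExecution P mentor T ε r cover) (ht : t < T) : I.present t ≤ mΩ :=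
  (h.present_le_past t ht).trans (h.past_le (t + 1) ht)

lemma measurableSet_mentor (h : I.IsExecution P mentor T ε r cover) (ht : t < T) (y : Y) :
    MeasurableSet[I.present t] {ω | indicatorPolicy mentor y (I.input t ω) = true} := by
  simpa [indicatorPolicy] using h.measurable_mentor t ht y

lemma measurableSet_bool_eq {Ω : Type*} {m : MeasurableSpace Ω} {f g : Ω → Bool}
    (hf : MeasurableSet[m] {ω | f ω = true}) (hg : MeasurableSet[m] {ω | g ω = true}) :
    MeasurableSet[m] {ω | f ω = g ω} :=
  measurableSet_eq_fun (measurable_to_bool hf) (measurable_to_bool hg)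

lemma measurable_loss (h : I.IsExecution P mentor T ε r cover) (ht : t < T) (he : e ∈ cover y) :
    Measurable[I.present t] fun ω => loss (indicatorPolicy mentor y) (I.inputs ω) t e :=
  measurable_ite_const (measurableSet_bool_eq (h.measurable_predict t ht y e he)
    (h.measurableSet_mentor ht y)) 0 1

lemma measurable_bestLoss (h : I.IsExecution P mentor T ε r cover) (ht : t < T)
    (hC : (cover y).Nonempty) :
    Measurable[I.present t] fun ω =>
      bestLoss (cover y) (indicatorPolicy mentor y) (I.inputs ω) t := by
  refine measurable_of_Ici fun a => ?_
  have : (fun ω => bestLoss (cover y) (indicatorPolicy mentor y) (I.inputs ω) t) ⁻¹' Set.Ici a =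
      ⋂ e ∈ cover y, (fun ω => loss (indicatorPolicy mentor y) (I.inputs ω) t e) ⁻¹'
        Set.Ici a := by
    ext ω
    simp only [Set.mem_preimage, Set.mem_Ici, Set.mem_iInter]
    refine ⟨fun hω e he => hω.trans (bestLoss_le he), fun hω => ?_⟩
    obtain ⟨e, he, h'⟩ := exists_loss_eq_bestLoss (f := indicatorPolicy mentor y)
      (xs := I.inputs ω) (t := t) hC
    exact h' ▸ hω e he
  rw [this]
  exact Finset.measurableSet_biInter _ fun e he => h.measurable_loss ht he measurableSet_Ici

lemma measurable_gap (h : I.IsExecution P mentor T ε r cover) (ht : t < T) (he : e ∈ cover y) :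
    Measurable[I.present t] fun ω =>
      gap (cover y) (indicatorPolicy mentor y) (I.inputs ω) t e :=
  (h.measurable_loss ht he).sub (h.measurable_bestLoss ht ⟨e, he⟩)

lemma measurable_weight (h : I.IsExecution P mentor T ε r cover) (ht : t ≤ T) (he : e ∈ cover y) :
    Measurable[I.past t] fun ω => weight T ε (cover y) (indicatorPolicy mentor y) (I.inputs ω)
      (fun s => I.coin s ω y) t e := by
  induction t with
  | zero => exact measurable_const
  | succ t ih =>
    have h1 := (ih (by omega)).mono ((h.past_le_present t ht).trans (h.present_le_past t ht)) le_rfl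
    have h2 := (h.measurable_gap ht he).mono (h.present_le_past t ht) le_rfl
    refine Measurable.ite (h.measurable_coin t ht y) (h1.mul ?_) h1
    exact Real.measurable_exp.comp ((measurable_const.mul (h2.div measurable_const)).neg)

lemma measurable_hedgeProb (h : I.IsExecution P mentor T ε r cover) (ht : t < T)
    (he : e ∈ cover y) :
    Measurable[I.present t] fun ω => hedgeProb T ε (cover y) (indicatorPolicy mentor y)
      (I.inputs ω) (fun s => I.coin s ω y) t e := by
  have h1 : ∀ e ∈ cover y, Measurable[I.present t] fun ω =>
      weight T ε (cover y) (indicatorPolicy mentor y) (I.inputs ω) (fun s => I.coin s ω y) t e :=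
    fun e he => (h.measurable_weight ht.le he).mono (h.past_le_present t ht) le_rfl
  exact (h1 e he).div (Finset.measurable_fun_sum _ h1)

lemma measurable_hedgeGap (h : I.IsExecution P mentor T ε r cover) (ht : t < T) (y : Y) :
    Measurable[I.present t] fun ω => hedgeGap T ε (cover y) (indicatorPolicy mentor y)
      (I.inputs ω) (fun s => I.coin s ω y) t :=
  Finset.measurable_fun_sum _ fun _ he =>
    (h.measurable_hedgeProb ht he).mul (h.measurable_gap ht he)

lemma measurableSet_coin_eq (h : I.IsExecution P mentor T ε r cover) (ht : t < T) (y : Y)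
    (b : Bool) : MeasurableSet {ω | I.coin t ω y = b} :=
  measurable_to_bool (f := fun ω => I.coin t ω y) (h.past_le _ ht _ (h.measurable_coin t ht y))
    (MeasurableSet.singleton b)

lemma measurableSet_coin_draw (h : I.IsExecution P mentor T ε r cover) (ht : t < T) (b : Bool)
    (he : e ∈ cover y) : MeasurableSet {ω | I.coin t ω y = b ∧ I.draw t ω y = e} :=
  (h.measurableSet_coin_eq ht y b).inter (h.past_le _ ht _ (h.measurable_draw t ht y e he))

lemma policy_mem (h : I.IsExecution P mentor T ε r cover) (ht : t < T) (ω : Ω) (y : Y) :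
    I.policy t ω y ∈ cover y := by
  cases hc : I.coin t ω y with
  | true => exact (h.policy_query t ht ω y hc).1
  | false => exact h.policy_draw t ht ω y hc ▸ h.draw_mem t ht ω y

lemma measurableSet_proposal (h : I.IsExecution P mentor T ε r cover) (ht : t < T) (y : Y) :
    MeasurableSet[I.past (t + 1)] {ω | I.proposal t ω y = true} := by
  have : {ω | I.proposal t ω y = true} = ⋃ e ∈ cover y,
      {ω | I.policy t ω y = e} ∩ {ω | predict e (I.inputs ω) t = true} := by
    ext ω
    simp only [proposal, Set.mem_ofPred_eq, Set.mem_iUnion, Set.mem_inter_iff, exists_prop]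
    exact ⟨fun hω => ⟨_, h.policy_mem ht ω y, rfl, hω⟩, fun ⟨e, _, h1, h2⟩ => h1 ▸ h2⟩
  rw [this]
  exact Finset.measurableSet_biUnion _ fun e he => (h.measurable_policy t ht y e he).inter
    (h.present_le_past t ht _ (h.measurable_predict t ht y e he))

lemma measurable_mistake (h : I.IsExecution P mentor T ε r cover) (ht : t < T) (y : Y) :
    Measurable (I.mistake mentor t y) :=
  measurable_ite_const (h.past_le _ ht _ (measurableSet_bool_eq (h.measurableSet_proposal ht y)
    (h.present_le_past t ht _ (h.measurableSet_mentor ht y)))) 0 1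

/-- The law of the coin and the draw of a single copy. -/
lemma condExp_coin_draw [IsProbabilityMeasure P] (h : I.IsExecution P mentor T ε r cover)
    (ht : t < T) (hC : ∀ y, (cover y).Nonempty) (b : Bool) (he : e ∈ cover y) :
    P[Set.indicator {ω | I.coin t ω y = b ∧ I.draw t ω y = e} (fun _ => (1 : ℝ)) | I.present t]
      =ᵐ[P] fun ω => (if b = true then queryProb T ε else 1 - queryProb T ε) *
        hedgeProb T ε (cover y) (indicatorPolicy mentor y) (I.inputs ω)
          (fun s => I.coin s ω y) t e := by
  classical
  -- the values of all coins and draws that are compatible with the values `b` and `e` in copy `y`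
  set J : Y → Finset (Bool × Expert X) := fun y' =>
    if y' = y then {(b, e)} else Finset.univ ×ˢ cover y' with hJ
  set A : (Y → Bool × Expert X) → Set Ω := fun z =>
    {ω | I.coin t ω = (fun y' => (z y').1) ∧ I.draw t ω = fun y' => (z y').2} with hA
  have hmem : ∀ z ∈ Fintype.piFinset J, ∀ y', (z y').2 ∈ cover y' := by
    intro z hz y'
    have := Fintype.mem_piFinset.1 hz y'
    by_cases hy : y' = y
    · subst hy; simp only [hJ, if_true, Finset.mem_singleton] at this; rw [this]; exact he
    · simp only [hJ, if_neg hy, Finset.mem_product] at this; exact this.2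
  have hAmeas : ∀ z ∈ Fintype.piFinset J, MeasurableSet (A z) := by
    intro z hz
    have : A z = ⋂ y', {ω | I.coin t ω y' = (z y').1} ∩ {ω | I.draw t ω y' = (z y').2} := by
      ext ω
      simp only [hA, funext_iff, Set.mem_ofPred_eq, Set.mem_iInter, Set.mem_inter_iff, forall_and]
    rw [this]
    exact MeasurableSet.iInter fun y' => (h.measurableSet_coin_eq ht y' _).inter
      (h.past_le _ ht _ (h.measurable_draw t ht y' _ (hmem z hz y')))
  have hsum : Set.indicator {ω | I.coin t ω y = b ∧ I.draw t ω y = e} (fun _ => (1 : ℝ)) =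
      ∑ z ∈ Fintype.piFinset J, Set.indicator (A z) fun _ => (1 : ℝ) := by
    funext ω
    have hz : ∀ z, Set.indicator (A z) (fun _ => (1 : ℝ)) ω =
        if z = (fun y' => (I.coin t ω y', I.draw t ω y')) then 1 else 0 := by
      intro z
      have : ω ∈ A z ↔ z = (fun y' => (I.coin t ω y', I.draw t ω y')) := by
        simp only [hA, Set.mem_ofPred_eq, funext_iff, Prod.ext_iff, forall_and, eq_comm]
      by_cases hω : ω ∈ A z
      · rw [Set.indicator_of_mem hω, if_pos (this.1 hω)]
      · rw [Set.indicator_of_notMem hω, if_neg (mt this.2 hω)]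
    rw [Finset.sum_apply, Finset.sum_congr rfl fun z _ => hz z, Finset.sum_ite_eq']
    have hiff : (fun y' => (I.coin t ω y', I.draw t ω y')) ∈ Fintype.piFinset J ↔
        ω ∈ {ω | I.coin t ω y = b ∧ I.draw t ω y = e} := by
      simp only [Fintype.mem_piFinset, hJ, Set.mem_ofPred_eq]
      refine ⟨fun hz => by simpa using hz y, fun ⟨h1, h2⟩ y' => ?_⟩
      by_cases hy : y' = y
      · subst hy; simp [h1, h2]
      · simp [hy, h.draw_mem t ht ω y']
    by_cases hω : ω ∈ {ω | I.coin t ω y = b ∧ I.draw t ω y = e}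
    · rw [Set.indicator_of_mem hω, if_pos (hiff.2 hω)]
    · rw [Set.indicator_of_notMem hω, if_neg (mt hiff.1 hω)]
  rw [hsum]
  refine (condExp_finsetSum (fun z hz =>
    (integrable_const (1 : ℝ)).indicator (hAmeas z hz)) _).trans ?_
  have hlaw : ∀ᵐ ω ∂P, ∀ z ∈ Fintype.piFinset J,
      P[Set.indicator (A z) (fun _ => (1 : ℝ)) | I.present t] ω =
      ∏ y', (if (z y').1 = true then queryProb T ε else 1 - queryProb T ε) *
        hedgeProb T ε (cover y') (indicatorPolicy mentor y') (I.inputs ω)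
          (fun s => I.coin s ω y') t (z y').2 := by
    rw [Finset.eventually_all]
    exact fun z hz => h.law t ht (fun y' => (z y').1) (fun y' => (z y').2) (hmem z hz)
  filter_upwards [hlaw] with ω hω
  rw [Finset.sum_apply, Finset.sum_congr rfl hω, ← Finset.prod_univ_sum J fun y' c =>
    (if c.1 = true then queryProb T ε else 1 - queryProb T ε) *
        hedgeProb T ε (cover y') (indicatorPolicy mentor y') (I.inputs ω)
          (fun s => I.coin s ω y') t c.2, Fintype.prod_eq_single y]
  · simp [hJ]
  · intro y' hy
    simp only [hJ, if_neg hy]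
    rw [Finset.sum_product, Fintype.sum_bool]
    simp only [if_true, Bool.false_eq_true, if_false]
    rw [← Finset.mul_sum, ← Finset.mul_sum,
      sum_hedgeProb (hC y')]
    simp

lemma integral_indicator_mul_of_condExp [IsProbabilityMeasure P] {m : MeasurableSpace Ω}
    (hm : m ≤ mΩ) {A : Set Ω} (hA : MeasurableSet[mΩ] A) {φ g : Ω → ℝ}
    (hφ : P[Set.indicator A (fun _ => (1 : ℝ)) | m] =ᵐ[P] φ) (hg : Measurable[m] g)
    (hgi : Integrable g P) :
    ∫ ω, Set.indicator A g ω ∂P = ∫ ω, φ ω * g ω ∂P := by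
  have h0 : Set.indicator A g = Set.indicator A (fun _ => (1 : ℝ)) * g := by
    funext ω
    by_cases hω : ω ∈ A <;> simp [hω]
  have h1 : Integrable (Set.indicator A (fun _ => (1 : ℝ)) * g) P := h0 ▸ hgi.indicator hA
  have h2 := condExp_mul_of_stronglyMeasurable_right hg.stronglyMeasurable h1
    ((integrable_const (1 : ℝ)).indicator hA)
  rw [h0, ← integral_condExp hm]
  refine integral_congr_ae ?_
  filter_upwards [h2, hφ] with ω h3 h4
  rw [h3, Pi.mul_apply, h4]

lemma integral_coin_draw [IsProbabilityMeasure P] (h : I.IsExecution P mentor T ε r cover)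
    (ht : t < T) (hC : ∀ y, (cover y).Nonempty) (b : Bool) (he : e ∈ cover y) {g : Ω → ℝ}
    (hg : Measurable[I.present t] g) (hgi : Integrable g P) :
    ∫ ω, Set.indicator {ω | I.coin t ω y = b ∧ I.draw t ω y = e} g ω ∂P =
      (if b = true then queryProb T ε else 1 - queryProb T ε) *
        ∫ ω, hedgeProb T ε (cover y) (indicatorPolicy mentor y) (I.inputs ω)
          (fun s => I.coin s ω y) t e * g ω ∂P := by
  rw [integral_indicator_mul_of_condExp (h.present_le ht)
    (h.measurableSet_coin_draw ht b he) (h.condExp_coin_draw ht hC b he) hg hgi,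
    ← integral_const_mul]
  simp only [mul_assoc]

lemma integrable_of_mem_Icc [IsFiniteMeasure P] {g : Ω → ℝ} (hg : Measurable g)
    (h0 : ∀ ω, 0 ≤ g ω) (h1 : ∀ ω, g ω ≤ 1) : Integrable g P :=
  Integrable.of_bound hg.aestronglyMeasurable 1
    (ae_of_all _ fun ω => by rw [Real.norm_of_nonneg (h0 ω)]; exact h1 ω)

/-- The coin of a copy is independent of everything that precedes it. -/
lemma integral_coin [IsProbabilityMeasure P] (h : I.IsExecution P mentor T ε r cover)
    (ht : t < T) (hC : ∀ y, (cover y).Nonempty) (y : Y) {g : Ω → ℝ}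
    (hg : Measurable[I.present t] g) (h0 : ∀ ω, 0 ≤ g ω) (h1 : ∀ ω, g ω ≤ 1) :
    ∫ ω, (if I.coin t ω y = true then g ω else 0) ∂P = queryProb T ε * ∫ ω, g ω ∂P := by
  have hgi : Integrable g P := integrable_of_mem_Icc (hg.mono (h.present_le ht) le_rfl) h0 h1
  have hsum : ∀ ω, (if I.coin t ω y = true then g ω else 0) =
      ∑ e ∈ cover y, Set.indicator {ω | I.coin t ω y = true ∧ I.draw t ω y = e} g ω := by
    classical
    intro ω
    simp only [Set.indicator_apply, Set.mem_ofPred_eq]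
    by_cases hc : I.coin t ω y = true
    · simp [hc, h.draw_mem t ht ω y]
    · simp [hc]
  simp only [hsum]
  rw [integral_finsetSum _ fun e he => hgi.indicator (h.measurableSet_coin_draw ht true he),
    Finset.sum_congr rfl fun e he => h.integral_coin_draw ht hC true he hg hgi]
  simp only [if_true]
  rw [← Finset.mul_sum, ← integral_finsetSum _ fun e he => ?_]
  · congr 1
    refine integral_congr_ae (ae_of_all _ fun ω => ?_)
    simp only
    rw [← Finset.sum_mul, sum_hedgeProb (hC y), one_mul]
  · refine integrable_of_mem_Icc
      (((h.measurable_hedgeProb ht he).mul hg).mono (h.present_le ht) le_rfl)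
      (fun ω => mul_nonneg hedgeProb_nonneg (h0 ω))
      (fun ω => mul_le_one₀ (hedgeProb_le_one he) (h0 ω) (h1 ω))

/-- Without a Hedge query, the expected excess loss of the sampled expert is at most the expected
excess loss of the Hedge distribution. -/
lemma integral_mistake_le [IsProbabilityMeasure P] (h : I.IsExecution P mentor T ε r cover)
    (ht : t < T) (hC : ∀ y, (cover y).Nonempty) (hp0 : 0 ≤ queryProb T ε) (y : Y) :
    ∫ ω, I.mistake mentor t y ω ∂P ≤
      ∫ ω, bestLoss (cover y) (indicatorPolicy mentor y) (I.inputs ω) t ∂P +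
        ∫ ω, hedgeGap T ε (cover y) (indicatorPolicy mentor y) (I.inputs ω)
          (fun s => I.coin s ω y) t ∂P := by
  set gp : Expert X → Ω → ℝ := fun e ω =>
    gap (cover y) (indicatorPolicy mentor y) (I.inputs ω) t e with hgp
  have hgi : ∀ e ∈ cover y, Integrable (gp e) P := fun e he =>
    integrable_of_mem_Icc ((h.measurable_gap ht he).mono (h.present_le ht) le_rfl)
      (fun ω => gap_nonneg he) (fun ω => gap_le_one he)
  have hbi : Integrable (fun ω =>
      bestLoss (cover y) (indicatorPolicy mentor y) (I.inputs ω) t) P :=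
    integrable_of_mem_Icc ((h.measurable_bestLoss ht (hC y)).mono (h.present_le ht) le_rfl)
      (fun ω => bestLoss_nonneg (hC y)) (fun ω => bestLoss_le_one (hC y))
  have hpt : ∀ ω, I.mistake mentor t y ω ≤
      bestLoss (cover y) (indicatorPolicy mentor y) (I.inputs ω) t +
      ∑ e ∈ cover y, Set.indicator {ω | I.coin t ω y = false ∧ I.draw t ω y = e} (gp e) ω := by
    intro ω
    have hnn : ∀ e ∈ cover y,
        0 ≤ Set.indicator {ω | I.coin t ω y = false ∧ I.draw t ω y = e} (gp e) ω :=
      fun e he => Set.indicator_nonneg (fun ω _ => gap_nonneg he) ω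
    cases hc : I.coin t ω y with
    | true =>
      obtain ⟨e, he, h'⟩ := exists_loss_eq_bestLoss (f := indicatorPolicy mentor y)
        (xs := I.inputs ω) (t := t) (hC y)
      have := (h.policy_query t ht ω y hc).2 e he
      rw [← h']
      exact this.trans (le_add_of_nonneg_right (Finset.sum_nonneg hnn))
    | false =>
      have he := h.draw_mem t ht ω y
      have h1 := Finset.single_le_sum hnn he
      rw [Set.indicator_of_mem (show ω ∈ {ω' | I.coin t ω' y = false ∧
        I.draw t ω' y = I.draw t ω y} from ⟨hc, rfl⟩)] at h1
      rw [mistake, h.policy_draw t ht ω y hc]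
      simp only [hgp, gap] at h1 ⊢
      linarith
  have hqi : ∀ e ∈ cover y, Integrable (fun ω => hedgeProb T ε (cover y)
      (indicatorPolicy mentor y) (I.inputs ω) (fun s => I.coin s ω y) t e * gp e ω) P :=
    fun e he => integrable_of_mem_Icc (((h.measurable_hedgeProb ht he).mul
      (h.measurable_gap ht he)).mono (h.present_le ht) le_rfl)
      (fun ω => mul_nonneg hedgeProb_nonneg (gap_nonneg he))
      (fun ω => mul_le_one₀ (hedgeProb_le_one he) (gap_nonneg he) (gap_le_one he))
  have hsi := integrable_finsetSum (cover y) fun e he =>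
    (hgi e he).indicator (h.measurableSet_coin_draw ht false he)
  calc ∫ ω, I.mistake mentor t y ω ∂P
      ≤ ∫ ω, (bestLoss (cover y) (indicatorPolicy mentor y) (I.inputs ω) t +
        ∑ e ∈ cover y, Set.indicator {ω | I.coin t ω y = false ∧ I.draw t ω y = e} (gp e) ω) ∂P :=
        integral_mono (integrable_of_mem_Icc (h.measurable_mistake ht y)
          (I.mistake_nonneg mentor t y) (I.mistake_le_one mentor t y)) (hbi.add hsi) hpt
    _ = ∫ ω, bestLoss (cover y) (indicatorPolicy mentor y) (I.inputs ω) t ∂P +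
        (1 - queryProb T ε) * ∫ ω, hedgeGap T ε (cover y) (indicatorPolicy mentor y)
          (I.inputs ω) (fun s => I.coin s ω y) t ∂P := by
        rw [integral_add hbi hsi,
          integral_finsetSum _ fun e he =>
            (hgi e he).indicator (h.measurableSet_coin_draw ht false he),
          Finset.sum_congr rfl fun e he =>
            h.integral_coin_draw ht hC false he (h.measurable_gap ht he) (hgi e he)]
        simp only [Bool.false_eq_true, if_false, hedgeGap]
        rw [← Finset.mul_sum, integral_finsetSum _ hqi]
    _ ≤ _ := by
        gcongr
        refine mul_le_of_le_one_left (integral_nonneg fun ω => hedgeGap_nonneg) (by linarith)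

/-- The expected number of mistakes of a copy, if on every realization some expert of the cover has
loss at most `G t` at every time `t`. -/
lemma sum_integral_mistake_le [IsProbabilityMeasure P] (h : I.IsExecution P mentor T ε r cover)
    (hC : ∀ y, (cover y).Nonempty) (hT : 0 < T) (hp0 : 0 < queryProb T ε)
    (hp1 : queryProb T ε ≤ 1) (y : Y) {δ : ℝ} (G : ℕ → Ω → ℝ)
    (hGm : ∀ t < T, Measurable[I.present t] (G t)) (hG0 : ∀ t < T, ∀ ω, 0 ≤ G t ω)
    (hG1 : ∀ t < T, ∀ ω, G t ω ≤ 1) (hGδ : ∀ t < T, ∫ ω, G t ω ∂P ≤ δ)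
    (hG : ∀ ω, ∃ e ∈ cover y, ∀ t < T,
      loss (indicatorPolicy mentor y) (I.inputs ω) t e ≤ G t ω) :
    ∑ t ∈ Finset.range T, ∫ ω, I.mistake mentor t y ω ∂P ≤
      3 * (Real.log (cover y).card / queryProb T ε ^ 2) + 3 * (T * δ) := by
  set hg : ℕ → Ω → ℝ := fun t ω => hedgeGap T ε (cover y) (indicatorPolicy mentor y)
    (I.inputs ω) (fun s => I.coin s ω y) t with hhg
  set u := rate T ε (cover y).card with hu
  have hu0 : 0 ≤ u := div_nonneg (le_trans (Real.sqrt_nonneg _) (le_max_left _ _)) hp0.le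
  have hg0 : ∀ t ω, 0 ≤ hg t ω := fun t ω => hedgeGap_nonneg
  have hg1 : ∀ t ω, hg t ω ≤ 1 := fun t ω => hedgeGap_le_one (hC y)
  have hgm : ∀ t < T, Measurable[I.present t] (hg t) := fun t ht => h.measurable_hedgeGap ht y
  have hGi : ∀ t < T, Integrable (G t) P := fun t ht =>
    integrable_of_mem_Icc ((hGm t ht).mono (h.present_le ht) le_rfl) (hG0 t ht) (hG1 t ht)
  have hgi : ∀ t < T, Integrable (hg t) P := fun t ht =>
    integrable_of_mem_Icc ((hgm t ht).mono (h.present_le ht) le_rfl) (hg0 t) (hg1 t)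
  have hci : ∀ t < T, ∀ f : Ω → ℝ, Integrable f P →
      Integrable (fun ω => if I.coin t ω y = true then f ω else 0) P := by
    intro t ht f hf
    have := hf.indicator (h.measurableSet_coin_eq ht y true)
    refine this.congr (ae_of_all _ fun ω => ?_)
    by_cases hc : I.coin t ω y = true <;> simp [Set.indicator, hc]
  have hmem : ∀ {t}, t ∈ Finset.range T → t < T := fun ht => Finset.mem_range.1 ht
  have hpath : ∀ ω, (∑ t ∈ Finset.range T, if I.coin t ω y = true then hg t ω else 0) *
      (1 - Real.exp (-u)) ≤ Real.log (cover y).card +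
        u * ∑ t ∈ Finset.range T, if I.coin t ω y = true then G t ω else 0 := by
    intro ω
    obtain ⟨e, he, hle⟩ := hG ω
    refine (sum_hedgeGap_mul_le he T).trans ?_
    gcongr with t ht
    split_ifs
    · exact (gap_le_loss he).trans (hle t (hmem ht))
    · exact le_rfl
  have hint := integral_mono
    ((integrable_finsetSum (Finset.range T) fun t ht =>
      hci t (hmem ht) _ (hgi t (hmem ht))).mul_const (1 - Real.exp (-u)))
    ((integrable_const (Real.log (cover y).card)).add ((integrable_finsetSum (Finset.range T)
      fun t ht => hci t (hmem ht) _ (hGi t (hmem ht))).const_mul u)) hpath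
  rw [integral_mul_const, integral_add' (integrable_const _) ((integrable_finsetSum (Finset.range T)
      fun t ht => hci t (hmem ht) _ (hGi t (hmem ht))).const_mul u), integral_const_mul,
    integral_finsetSum _ fun t ht => hci t (hmem ht) _ (hgi t (hmem ht)),
    integral_finsetSum _ fun t ht => hci t (hmem ht) _ (hGi t (hmem ht)),
    Finset.sum_congr rfl fun t ht =>
      h.integral_coin (hmem ht) hC y (hgm t (hmem ht)) (hg0 t) (hg1 t),
    Finset.sum_congr rfl fun t ht =>
      h.integral_coin (hmem ht) hC y (hGm t (hmem ht)) (hG0 t (hmem ht)) (hG1 t (hmem ht)),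
    ← Finset.mul_sum, ← Finset.mul_sum] at hint
  simp only [integral_const, probReal_univ, one_smul] at hint
  have hle1 : ∀ f : Ω → ℝ, Integrable f P → (∀ ω, f ω ≤ 1) → ∫ ω, f ω ∂P ≤ 1 := by
    intro f hf hf1
    simpa using integral_mono hf (integrable_const (1 : ℝ)) hf1
  have hS := le_of_rate_inequality (S := ∑ t ∈ Finset.range T, ∫ ω, hg t ω ∂P)
    (G := ∑ t ∈ Finset.range T, ∫ ω, G t ω ∂P) (N := (cover y).card) hT hp0 hp1
    (Finset.sum_nonneg fun t _ => integral_nonneg (hg0 t))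
    (by
      have := Finset.sum_le_card_nsmul (Finset.range T) (fun t => ∫ ω, hg t ω ∂P) 1
        fun t ht => hle1 _ (hgi t (hmem ht)) (hg1 t)
      simpa using this)
    (Finset.sum_nonneg fun t ht => integral_nonneg (hG0 t (hmem ht)))
    (by linarith)
  have hGsum : ∑ t ∈ Finset.range T, ∫ ω, G t ω ∂P ≤ T * δ := by
    have := Finset.sum_le_card_nsmul (Finset.range T) (fun t => ∫ ω, G t ω ∂P) δ
      fun t ht => hGδ t (hmem ht)
    simpa using this
  have hm : ∑ t ∈ Finset.range T, ∫ ω, I.mistake mentor t y ω ∂P ≤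
      ∑ t ∈ Finset.range T, ∫ ω, G t ω ∂P + ∑ t ∈ Finset.range T, ∫ ω, hg t ω ∂P := by
    rw [← Finset.sum_add_distrib]
    refine Finset.sum_le_sum fun t ht => (h.integral_mistake_le (hmem ht) hC hp0.le y).trans ?_
    have : ∫ ω, bestLoss (cover y) (indicatorPolicy mentor y) (I.inputs ω) t ∂P ≤
        ∫ ω, G t ω ∂P := by
      refine integral_mono (integrable_of_mem_Icc ((h.measurable_bestLoss (hmem ht) (hC y)).mono
        (h.present_le (hmem ht)) le_rfl) (fun ω => bestLoss_nonneg (hC y))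
        (fun ω => bestLoss_le_one (hC y))) (hGi t (hmem ht)) fun ω => ?_
      obtain ⟨e, he, hle⟩ := hG ω
      exact (bestLoss_le he).trans (hle t (hmem ht))
    simp only [hhg]
    gcongr
  linarith

end Interaction.IsExecution

end Execution

/-! ### Separated points and the number of queries of one copy -/

/-- The volume bound for the number of `r`-separated points with mutual distances at most `D`. -/
lemma card_le_of_lt_dist {n : ℕ} (s : Finset (EuclideanSpace ℝ (Fin n))) {r D : ℝ} (hr : 0 < r)
    (hD : 0 ≤ D) (hsep : ∀ x ∈ s, ∀ y ∈ s, x ≠ y → r < dist x y)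
    (hdiam : ∀ x ∈ s, ∀ y ∈ s, dist x y ≤ D) : (s.card : ℝ) ≤ (1 + 2 * D / r) ^ n := by
  rcases s.eq_empty_or_nonempty with rfl | ⟨x₀, hx₀⟩
  · simp only [Finset.card_empty, Nat.cast_zero]; positivity
  set V : Measure (EuclideanSpace ℝ (Fin n)) := volume with hV
  have hdisj : (s : Set (EuclideanSpace ℝ (Fin n))).PairwiseDisjoint
      fun x => Metric.ball x (r / 2) := by
    intro x hx y hy hxy
    refine Metric.ball_disjoint_ball ?_
    have := hsep x hx y hy hxy
    linarith
  have hsub : (⋃ x ∈ s, Metric.ball x (r / 2)) ⊆ Metric.ball x₀ (D + r / 2) := by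
    refine Set.iUnion₂_subset fun x hx => Metric.ball_subset_ball' ?_
    have := hdiam x hx x₀ hx₀
    linarith
  have h1 : (s.card : ENNReal) * ENNReal.ofReal ((r / 2) ^ n) * V (Metric.ball 0 1) ≤
      ENNReal.ofReal ((D + r / 2) ^ n) * V (Metric.ball 0 1) := by
    calc (s.card : ENNReal) * ENNReal.ofReal ((r / 2) ^ n) * V (Metric.ball 0 1)
        = ∑ x ∈ s, V (Metric.ball x (r / 2)) := by
          simp only [Measure.addHaar_ball_of_pos V _ (half_pos hr), finrank_euclideanSpace_fin,
            Finset.sum_const, nsmul_eq_mul, mul_assoc]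
      _ = V (⋃ x ∈ s, Metric.ball x (r / 2)) :=
          (measure_biUnion_finset hdisj fun _ _ => measurableSet_ball).symm
      _ ≤ V (Metric.ball x₀ (D + r / 2)) := measure_mono hsub
      _ = _ := by
          rw [Measure.addHaar_ball_of_pos V _ (by positivity), finrank_euclideanSpace_fin]
  have h2 := (ENNReal.mul_le_mul_iff_left (Metric.measure_ball_pos V _ one_pos).ne'
    measure_ball_lt_top.ne).1 h1
  rw [← ENNReal.ofReal_natCast, ← ENNReal.ofReal_mul (Nat.cast_nonneg _),
    ENNReal.ofReal_le_ofReal_iff (by positivity)] at h2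
  rw [← le_div_iff₀ (by positivity), ← div_pow] at h2
  refine h2.trans (le_of_eq ?_)
  congr 1
  field_simp
  ring

section Recorded

variable {X : Type*} [Dist X] {r : ℝ} {f : X → Bool} {xs : ℕ → X} {pol : ℕ → Expert X}

lemma mem_recorded_iff {t : ℕ} {z : X × Bool} : z ∈ recorded r f xs pol t ↔
    ∃ s < t, z = (xs s, f (xs s)) ∧
      IsFar r (recorded r f xs pol s) (xs s) (predict (pol s) xs s) := by
  induction t with
  | zero => simp [recorded]
  | succ t ih =>
    rw [recorded, Set.mem_union, ih, Set.mem_ofPred_eq]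
    constructor
    · rintro (⟨s, hs, h⟩ | h)
      · exact ⟨s, by omega, h⟩
      · exact ⟨t, by omega, h⟩
    · rintro ⟨s, hs, h⟩
      rcases Nat.lt_succ_iff_lt_or_eq.1 hs with hs | rfl
      · exact Or.inl ⟨s, hs, h⟩
      · exact Or.inr h

lemma isFar_recorded_iff {t : ℕ} {x : X} {b : Bool} : IsFar r (recorded r f xs pol t) x b ↔
    ∀ s < t, IsFar r (recorded r f xs pol s) (xs s) (predict (pol s) xs s) → f (xs s) = b →
      r < dist x (xs s) := by
  constructor
  · intro h s hs hfar hb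
    exact h (xs s, f (xs s)) (mem_recorded_iff.2 ⟨s, hs, rfl, hfar⟩) hb
  · intro h z hz hb
    obtain ⟨s, hs, rfl, hfar⟩ := mem_recorded_iff.1 hz
    exact h s hs hfar hb

end Recorded

open Classical in
/-- A step at which the input is far from the examples with the proposed label is either a mistake,
or it records an input that is far from all inputs recorded before with the same label. -/
lemma card_isFar_le {n : ℕ} {X : Set (EuclideanSpace ℝ (Fin n))} {r : ℝ} (hr : 0 < r) (f : X → Bool)
    (xs : ℕ → X) (pol : ℕ → Expert X) (T : ℕ) :
    (((Finset.range T).filter fun t =>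
        IsFar r (recorded r f xs pol t) (xs t) (predict (pol t) xs t)).card : ℝ) ≤
      ∑ t ∈ Finset.range T, loss f xs t (pol t) +
        2 * (1 + 2 * Metric.diam (xs '' Set.Iio T) / r) ^ n := by
  set far : ℕ → Prop := fun t =>
    IsFar r (recorded r f xs pol t) (xs t) (predict (pol t) xs t) with hfar
  set R : Bool → Finset ℕ := fun b => (Finset.range T).filter fun t =>
    far t ∧ predict (pol t) xs t = f (xs t) ∧ f (xs t) = b with hR
  have hsep : ∀ b, ∀ s ∈ R b, ∀ t ∈ R b, s ≠ t → r < dist (xs s) (xs t) := by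
    have key : ∀ b, ∀ s ∈ R b, ∀ t ∈ R b, s < t → r < dist (xs t) (xs s) := by
      intro b s hs t ht hst
      obtain ⟨-, hs1, -, hs3⟩ := Finset.mem_filter.1 hs
      obtain ⟨-, ht1, ht2, ht3⟩ := Finset.mem_filter.1 ht
      exact isFar_recorded_iff.1 ht1 s hst hs1 (by rw [hs3, ht2, ht3])
    intro b s hs t ht hst
    rcases lt_or_gt_of_ne hst with h | h
    · rw [dist_comm]; exact key b s hs t ht h
    · exact key b t ht s hs h
  have hcard : ∀ b, ((R b).card : ℝ) ≤ (1 + 2 * Metric.diam (xs '' Set.Iio T) / r) ^ n := by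
    intro b
    have hinj : Set.InjOn (fun t => (xs t : EuclideanSpace ℝ (Fin n))) (R b) := by
      intro s hs t ht hst
      by_contra hne
      have h1 := hsep b s hs t ht hne
      rw [Subtype.ext hst, dist_self] at h1
      exact lt_asymm hr h1
    rw [← Finset.card_image_of_injOn hinj]
    have hmem : ∀ t ∈ R b, xs t ∈ xs '' Set.Iio T := fun t ht =>
      ⟨t, Finset.mem_range.1 (Finset.mem_filter.1 ht).1, rfl⟩
    refine card_le_of_lt_dist _ hr Metric.diam_nonneg ?_ ?_
    · intro x hx y hy hxy
      obtain ⟨s, hs, rfl⟩ := Finset.mem_image.1 hx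
      obtain ⟨t, ht, rfl⟩ := Finset.mem_image.1 hy
      exact hsep b s hs t ht fun h => hxy (by rw [h])
    · intro x hx y hy
      obtain ⟨s, hs, rfl⟩ := Finset.mem_image.1 hx
      obtain ⟨t, ht, rfl⟩ := Finset.mem_image.1 hy
      exact Metric.dist_le_diam_of_mem ((Set.finite_Iio T).image xs).isBounded (hmem s hs)
        (hmem t ht)
  have hsub : (Finset.range T).filter far ⊆
      ((Finset.range T).filter fun t => predict (pol t) xs t ≠ f (xs t)) ∪ (R true ∪ R false) := by
    intro t ht
    obtain ⟨h1, h2⟩ := Finset.mem_filter.1 ht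
    by_cases h : predict (pol t) xs t = f (xs t)
    · refine Finset.mem_union_right _ ?_
      cases hb : f (xs t)
      · exact Finset.mem_union_right _ (Finset.mem_filter.2 ⟨h1, h2, h, hb⟩)
      · exact Finset.mem_union_left _ (Finset.mem_filter.2 ⟨h1, h2, h, hb⟩)
    · exact Finset.mem_union_left _ (Finset.mem_filter.2 ⟨h1, h⟩)
  have hloss : ∑ t ∈ Finset.range T, loss f xs t (pol t) =
      ((Finset.range T).filter fun t => predict (pol t) xs t ≠ f (xs t)).card := by
    rw [Finset.card_filter, Nat.cast_sum]
    refine Finset.sum_congr rfl fun t _ => ?_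
    unfold loss
    by_cases h : predict (pol t) xs t = f (xs t) <;> simp [h]
  have h1 := ((Finset.card_le_card hsub).trans (Finset.card_union_le _ _)).trans
    (Nat.add_le_add_left (Finset.card_union_le _ _) _)
  have h2 : (((Finset.range T).filter far).card : ℝ) ≤
      ((Finset.range T).filter fun t => predict (pol t) xs t ≠ f (xs t)).card +
        ((R true).card + (R false).card) := by exact_mod_cast h1
  rw [hloss]
  linarith [hcard true, hcard false]

/-! ### Payoffs on one realization -/

namespace Interaction.IsExecution

section Pathwise

variable {Ω X Y : Type*} [MetricSpace X] [MeasurableSpace X] [Fintype Y] [mΩ : MeasurableSpace Ω]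
  {P : Measure Ω} {I : Interaction Ω X Y} {mentor : X → Y} {T : ℕ} {ε r : ℝ}
  {cover : Y → Finset (Expert X)} {t : ℕ}

/-- An action without a query is the mentor's action at some input near the current one. -/
lemma exists_near_input (h : I.IsExecution P mentor T ε r cover) (ht : t < T) {ω : Ω}
    (hq : ¬ I.Queries mentor r t ω) :
    ∃ x', dist (I.input t ω) x' ≤ r ∧ I.action t ω = mentor x' := by
  by_cases hv : ∃ y, I.proposal t ω y = true
  · have hprop := h.action_vote t ht ω hq hv
    have hask : ¬ I.CopyAsks mentor r t ω (I.action t ω) := fun hask => hq ⟨_, hask⟩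
    have hfar := (not_or.1 hask).2
    rw [isFar_recorded_iff] at hfar
    push Not at hfar
    obtain ⟨s, -, -, hlab, hdist⟩ := hfar
    refine ⟨I.input s ω, hdist, ?_⟩
    have h1 : indicatorPolicy mentor (I.action t ω) (I.input s ω) = true := hlab.trans hprop
    simpa [indicatorPolicy, eq_comm] using h1
  · push Not at hv
    obtain ⟨y, z, -, hdist, hact⟩ := h.action_fallback t ht ω hq (by simpa using hv)
    exact ⟨z.1, hdist, hact⟩

/-- If all the proposals are right and no copy asks, the agent takes the mentor's action. -/
lemma exists_proposal_ne (h : I.IsExecution P mentor T ε r cover) (ht : t < T) {ω : Ω}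
    (hq : ¬ I.Queries mentor r t ω) (hne : I.action t ω ≠ mentor (I.input t ω)) :
    ∃ y, I.proposal t ω y ≠ indicatorPolicy mentor y (I.input t ω) := by
  by_contra! hall
  have h1 : I.proposal t ω (mentor (I.input t ω)) = true := by
    rw [hall]; simp [indicatorPolicy]
  have h2 := h.action_vote t ht ω hq ⟨_, h1⟩
  rw [hall] at h2
  exact hne (by simpa [indicatorPolicy, eq_comm] using h2)

lemma mentorPayoff_sub_le (h : I.IsExecution P mentor T ε r cover) {L : ℝ} (hL : 0 ≤ L)
    (hr : 0 ≤ r) (hloc : I.LocalGeneralization mentor T L) (ht : t < T) (ω : Ω) :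
    I.mentorPayoff mentor t ω - I.agentPayoff mentor r t ω ≤ L * r := by
  unfold agentPayoff
  split_ifs with hq
  · rw [sub_self]; positivity
  · obtain ⟨x', hd, hact⟩ := h.exists_near_input ht hq
    rw [hact]
    exact (le_abs_self _).trans ((hloc t ht ω _ x').trans (by gcongr))

lemma mentorPayoff_sub_le_mistakes (h : I.IsExecution P mentor T ε r cover) {L : ℝ} (hL : 0 ≤ L)
    (hr : 0 ≤ r) (hloc : I.LocalGeneralization mentor T L) (ht : t < T) (ω : Ω) :
    I.mentorPayoff mentor t ω - I.agentPayoff mentor r t ω ≤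
      L * r * ∑ y, I.mistake mentor t y ω := by
  have hnn : 0 ≤ ∑ y, I.mistake mentor t y ω :=
    Finset.sum_nonneg fun y _ => I.mistake_nonneg mentor t y ω
  by_cases heq : I.Queries mentor r t ω ∨ I.action t ω = mentor (I.input t ω)
  · have : I.mentorPayoff mentor t ω - I.agentPayoff mentor r t ω = 0 := by
      unfold agentPayoff mentorPayoff
      split_ifs with hq
      · simp
      · rw [heq.resolve_left hq, sub_self]
    rw [this]
    positivity
  · push Not at heq
    obtain ⟨y, hy⟩ := h.exists_proposal_ne ht heq.1 heq.2
    have h1 : I.mistake mentor t y ω = 1 := if_neg hy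
    have h2 : 1 ≤ ∑ y, I.mistake mentor t y ω := h1 ▸ Finset.single_le_sum
      (f := fun y => I.mistake mentor t y ω) (fun y _ => I.mistake_nonneg mentor t y ω)
      (Finset.mem_univ y)
    calc _ ≤ L * r := h.mentorPayoff_sub_le hL hr hloc ht ω
      _ ≤ L * r * ∑ y, I.mistake mentor t y ω := le_mul_of_one_le_right (by positivity) h2

lemma mentorPayoff_mem {Ω X Y : Type*} {I : Interaction Ω X Y} {mentor : X → Y} {T t : ℕ}
    (hpay : I.PayoffsInUnitInterval T) (ht : t < T) (ω : Ω) :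
    0 ≤ I.mentorPayoff mentor t ω ∧ I.mentorPayoff mentor t ω ≤ 1 := hpay t ht ω _ _

lemma agentPayoff_mem {Ω X Y : Type*} [Dist X] {I : Interaction Ω X Y} {mentor : X → Y}
    {T t : ℕ} {r : ℝ} (hpay : I.PayoffsInUnitInterval T) (ht : t < T) (ω : Ω) :
    0 ≤ I.agentPayoff mentor r t ω ∧ I.agentPayoff mentor r t ω ≤ 1 := by
  unfold agentPayoff
  split_ifs
  · exact mentorPayoff_mem hpay ht ω
  · exact hpay t ht ω _ _

/-! ### Measurability of the agent's behaviour -/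

lemma measurable_eval_of_fintype {Ω Y : Type*} [Fintype Y] [MeasurableSpace Ω] {g : Ω → Y → ℝ}
    {z : Ω → Y} (hz : ∀ y, MeasurableSet {ω | z ω = y}) (hg : ∀ y, Measurable fun ω => g ω y) :
    Measurable fun ω => g ω (z ω) := by
  classical
  have : (fun ω => g ω (z ω)) = fun ω => ∑ y, if z ω = y then g ω y else 0 := by
    funext ω; simp
  rw [this]
  exact Finset.measurable_fun_sum _ fun y _ => Measurable.ite (hz y) (hg y) measurable_const

lemma measurable_mentorPayoff (h : I.IsExecution P mentor T ε r cover) (ht : t < T) :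
    Measurable (I.mentorPayoff mentor t) :=
  measurable_eval_of_fintype (g := fun ω y => I.payoff t ω (I.input t ω) y)
    (z := fun ω => mentor (I.input t ω))
    (fun y => h.present_le ht _ (h.measurable_mentor t ht y))
    fun y => (h.measurable_payoff t ht y).mono (h.present_le ht) le_rfl

variable [OpensMeasurableSpace X] [SecondCountableTopology X]

lemma measurableSet_isFar (h : I.IsExecution P mentor T ε r cover) (ht : t < T) (y : Y) :
    MeasurableSet {ω | IsFar r (I.examples mentor r t ω y) (I.input t ω) (I.proposal t ω y)} := by
  induction t using Nat.strong_induction_on with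
  | _ t ih =>
    have heq : {ω | IsFar r (I.examples mentor r t ω y) (I.input t ω) (I.proposal t ω y)} =
        ⋂ s ∈ Finset.range t, {ω |
          IsFar r (I.examples mentor r s ω y) (I.input s ω) (I.proposal s ω y) →
          indicatorPolicy mentor y (I.input s ω) = I.proposal t ω y →
          r < dist (I.input t ω) (I.input s ω)} := by
      ext ω
      simp only [Set.mem_ofPred_eq, examples, Set.mem_iInter, Finset.mem_range]
      exact isFar_recorded_iff
    rw [heq]
    refine Finset.measurableSet_biInter _ fun s hs => ?_
    have hs : s < t := Finset.mem_range.1 hs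
    have hi : ∀ s < T, Measurable (I.input s) := fun s hs =>
      (h.measurable_input s hs).mono (h.present_le hs) le_rfl
    refine (ih s hs (hs.trans ht)).imp ((measurableSet_bool_eq ?_ ?_).imp
      (measurableSet_lt measurable_const ((hi t ht).dist (hi s (hs.trans ht)))))
    · exact h.present_le (hs.trans ht) _ (h.measurableSet_mentor (hs.trans ht) y)
    · exact h.past_le _ ht _ (h.measurableSet_proposal ht y)

lemma measurableSet_queries (h : I.IsExecution P mentor T ε r cover) (ht : t < T) :
    MeasurableSet {ω | I.Queries mentor r t ω} := by
  have : {ω | I.Queries mentor r t ω} = ⋃ y, ({ω | I.coin t ω y = true} ∪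
      {ω | IsFar r (I.examples mentor r t ω y) (I.input t ω) (I.proposal t ω y)}) := by
    ext ω
    simp only [Queries, CopyAsks, Asks, Set.mem_ofPred_eq, Set.mem_iUnion, Set.mem_union]
    rfl
  rw [this]
  exact MeasurableSet.iUnion fun y =>
    (h.measurableSet_coin_eq ht y true).union (h.measurableSet_isFar ht y)

lemma measurable_agentPayoff (h : I.IsExecution P mentor T ε r cover) (ht : t < T) :
    Measurable (I.agentPayoff mentor r t) := by
  classical
  refine Measurable.ite (h.measurableSet_queries ht) (h.measurable_mentorPayoff ht) ?_
  exact measurable_eval_of_fintype (g := fun ω y => I.payoff t ω (I.input t ω) y)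
    (z := fun ω => I.action t ω) (fun y => h.past_le _ ht _ (h.measurable_action t ht y))
    fun y => (h.measurable_payoff t ht y).mono (h.present_le ht) le_rfl

end Pathwise

/-- The number of queries on one realization. -/
lemma queryCount_le {n : ℕ} {X : Set (EuclideanSpace ℝ (Fin n))} {Ω Y : Type*} [Fintype Y]
    (I : Interaction Ω X Y) (mentor : X → Y) {r : ℝ} (hr : 0 < r) (T : ℕ) (ω : Ω) :
    (I.queryCount mentor r T ω : ℝ) ≤
      ∑ y, ∑ t ∈ Finset.range T, ((if I.coin t ω y = true then 1 else 0) +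
        I.mistake mentor t y ω) +
      Fintype.card Y * (2 * (1 + 2 * I.inputDiam T ω / r) ^ n) := by
  classical
  set cn : Y → Finset ℕ := fun y => (Finset.range T).filter fun t => I.coin t ω y = true with hcn
  set fr : Y → Finset ℕ := fun y => (Finset.range T).filter fun t =>
    IsFar r (recorded r (indicatorPolicy mentor y) (I.inputs ω) (fun s => I.policy s ω y) t)
      (I.inputs ω t) (predict (I.policy t ω y) (I.inputs ω) t) with hfr
  have h1 : {t : ℕ | t < T ∧ I.Queries mentor r t ω} ⊆
      ((Finset.univ.biUnion fun y => cn y ∪ fr y : Finset ℕ) : Set ℕ) := by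
    rintro t ⟨ht, y, hy⟩
    simp only [Finset.coe_biUnion, Set.mem_iUnion, Finset.mem_coe, Finset.mem_union, hcn, hfr,
      Finset.mem_filter, Finset.mem_range, ht, true_and, Finset.mem_univ, exists_prop]
    exact ⟨y, hy⟩
  have h2 : I.queryCount mentor r T ω ≤ ∑ y, ((cn y).card + (fr y).card) := by
    calc I.queryCount mentor r T ω
        ≤ ((Finset.univ.biUnion fun y => cn y ∪ fr y : Finset ℕ) : Set ℕ).ncard :=
          Set.ncard_le_ncard h1 (Finset.finite_toSet _)
      _ = (Finset.univ.biUnion fun y => cn y ∪ fr y).card := Set.ncard_coe_finset _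
      _ ≤ ∑ y, (cn y ∪ fr y).card := Finset.card_biUnion_le
      _ ≤ _ := Finset.sum_le_sum fun y _ => Finset.card_union_le _ _
  have h3 : (I.queryCount mentor r T ω : ℝ) ≤ ∑ y, (((cn y).card : ℝ) + (fr y).card) := by
    exact_mod_cast h2
  refine h3.trans ?_
  calc ∑ y, (((cn y).card : ℝ) + (fr y).card)
      ≤ ∑ y, (∑ t ∈ Finset.range T, ((if I.coin t ω y = true then 1 else 0) +
          I.mistake mentor t y ω) + 2 * (1 + 2 * I.inputDiam T ω / r) ^ n) := by
        refine Finset.sum_le_sum fun y _ => ?_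
        have hc : ((cn y).card : ℝ) =
            ∑ t ∈ Finset.range T, if I.coin t ω y = true then (1 : ℝ) else 0 := by
          rw [hcn, Finset.card_filter]; push_cast; rfl
        have hf := card_isFar_le hr (indicatorPolicy mentor y) (I.inputs ω)
          (fun s => I.policy s ω y) T
        rw [hc, Finset.sum_add_distrib, add_assoc]
        gcongr
        exact hf
    _ = _ := by
        rw [Finset.sum_add_distrib, Finset.sum_const, nsmul_eq_mul, Finset.card_univ]

end Interaction.IsExecution

/-! ### Expected regret and expected number of queries -/

namespace Interaction.IsExecution

section Regret

variable {Ω X Y : Type*} [MetricSpace X] [MeasurableSpace X] [Fintype Y] [mΩ : MeasurableSpace Ω]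
  {P : Measure Ω} [IsProbabilityMeasure P] {I : Interaction Ω X Y} {mentor : X → Y} {T : ℕ}
  {ε r : ℝ} {cover : Y → Finset (Expert X)}

lemma integrable_mistake (h : I.IsExecution P mentor T ε r cover) {t : ℕ} (ht : t < T) (y : Y) :
    Integrable (I.mistake mentor t y) P :=
  integrable_of_mem_Icc (h.measurable_mistake ht y) (I.mistake_nonneg mentor t y)
    (I.mistake_le_one mentor t y)

lemma integral_sum_sum_mistake_le (h : I.IsExecution P mentor T ε r cover) {B : ℝ}
    (hB : ∀ y, ∑ t ∈ Finset.range T, ∫ ω, I.mistake mentor t y ω ∂P ≤ B) :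
    ∫ ω, ∑ t ∈ Finset.range T, ∑ y, I.mistake mentor t y ω ∂P ≤ Fintype.card Y * B := by
  rw [integral_finsetSum _ fun t ht => integrable_finsetSum _ fun y _ =>
    h.integrable_mistake (Finset.mem_range.1 ht) y]
  rw [Finset.sum_congr rfl fun t ht => integral_finsetSum _ fun y _ =>
    h.integrable_mistake (Finset.mem_range.1 ht) y, Finset.sum_comm]
  have := Finset.sum_le_card_nsmul Finset.univ _ B fun y _ => hB y
  simpa using this

variable [OpensMeasurableSpace X] [SecondCountableTopology X]

/-- Every mistake costs at most `L r`. -/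
lemma integral_additiveRegret_le (h : I.IsExecution P mentor T ε r cover) {L B : ℝ} (hL : 0 ≤ L)
    (hr : 0 ≤ r) (hpay : I.PayoffsInUnitInterval T) (hloc : I.LocalGeneralization mentor T L)
    (hB : ∀ y, ∑ t ∈ Finset.range T, ∫ ω, I.mistake mentor t y ω ∂P ≤ B) :
    Integrable (I.additiveRegret mentor r T) P ∧
      ∫ ω, I.additiveRegret mentor r T ω ∂P ≤ L * r * (Fintype.card Y * B) := by
  have hint : Integrable (I.additiveRegret mentor r T) P := by
    refine (integrable_finsetSum _ fun t ht => ?_).sub (integrable_finsetSum _ fun t ht => ?_)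
    · have ht := Finset.mem_range.1 ht
      exact integrable_of_mem_Icc (h.measurable_mentorPayoff ht)
        (fun ω => (mentorPayoff_mem hpay ht ω).1) (fun ω => (mentorPayoff_mem hpay ht ω).2)
    · have ht := Finset.mem_range.1 ht
      exact integrable_of_mem_Icc (h.measurable_agentPayoff ht)
        (fun ω => (agentPayoff_mem hpay ht ω).1) (fun ω => (agentPayoff_mem hpay ht ω).2)
  refine ⟨hint, ?_⟩
  calc ∫ ω, I.additiveRegret mentor r T ω ∂P
      ≤ ∫ ω, L * r * ∑ t ∈ Finset.range T, ∑ y, I.mistake mentor t y ω ∂P := by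
        refine integral_mono hint ((integrable_finsetSum _ fun t ht => integrable_finsetSum _
          fun y _ => h.integrable_mistake (Finset.mem_range.1 ht) y).const_mul _) fun ω => ?_
        simp only [additiveRegret]
        rw [← Finset.sum_sub_distrib, Finset.mul_sum]
        exact Finset.sum_le_sum fun t ht =>
          h.mentorPayoff_sub_le_mistakes hL hr hloc (Finset.mem_range.1 ht) ω
    _ ≤ _ := by
        rw [integral_const_mul]
        gcongr
        exact h.integral_sum_sum_mistake_le hB

/-- If `L r ≤ m / 2`, the agent's payoff is always at least `m / 2`, so that every mistake costs at
most `2 L r / m` in the logarithm of the payoff. -/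
lemma integral_multiplicativeRegret_le (h : I.IsExecution P mentor T ε r cover) {L B m : ℝ}
    (hL : 0 ≤ L) (hr : 0 ≤ r) (hpay : I.PayoffsInUnitInterval T)
    (hloc : I.LocalGeneralization mentor T L) (hm : 0 < m) (hmentor : I.MentorAtLeast mentor T m)
    (hLr : L * r ≤ m / 2)
    (hB : ∀ y, ∑ t ∈ Finset.range T, ∫ ω, I.mistake mentor t y ω ∂P ≤ B) :
    (∀ ω, I.multiplicativeRegret mentor r T ω ≠ ⊤) ∧
      Integrable (fun ω => (I.multiplicativeRegret mentor r T ω).toReal) P ∧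
      ∫ ω, (I.multiplicativeRegret mentor r T ω).toReal ∂P ≤
        2 / m * (L * r * (Fintype.card Y * B)) := by
  have hma : ∀ t < T, ∀ ω, m / 2 ≤ I.agentPayoff mentor r t ω := fun t ht ω => by
    have h1 := h.mentorPayoff_sub_le hL hr hloc ht ω
    have h2 := hmentor t ht ω
    linarith
  have hmm : ∀ t < T, ∀ ω, m / 2 ≤ I.mentorPayoff mentor t ω := fun t ht ω => by
    have h2 := hmentor t ht ω
    linarith
  have hm2 : 0 < m / 2 := half_pos hm
  have hval : ∀ ω, I.multiplicativeRegret mentor r T ω =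
      ((∑ t ∈ Finset.range T, (Real.log (I.mentorPayoff mentor t ω) -
        Real.log (I.agentPayoff mentor r t ω)) : ℝ) : EReal) := by
    intro ω
    rw [multiplicativeRegret, if_neg, Real.log_prod, Real.log_prod, Finset.sum_sub_distrib]
    · exact fun t ht => (hm2.trans_le (hma t (Finset.mem_range.1 ht) ω)).ne'
    · exact fun t ht => (hm2.trans_le (hmm t (Finset.mem_range.1 ht) ω)).ne'
    · rintro ⟨t, ht, h0⟩
      exact (hm2.trans_le (hma t ht ω)).ne' h0
  have hlogi : ∀ g : Ω → ℝ, Measurable g → (∀ ω, m / 2 ≤ g ω) → (∀ ω, g ω ≤ 1) →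
      Integrable (fun ω => Real.log (g ω)) P := by
    intro g hg h1 h2
    refine Integrable.of_bound hg.log.aestronglyMeasurable (-Real.log (m / 2))
      (ae_of_all _ fun ω => ?_)
    rw [Real.norm_eq_abs, abs_of_nonpos (Real.log_nonpos (hm2.le.trans (h1 ω)) (h2 ω))]
    exact neg_le_neg (Real.log_le_log hm2 (h1 ω))
  have hint : Integrable (fun ω => (I.multiplicativeRegret mentor r T ω).toReal) P := by
    simp only [hval, EReal.toReal_coe]
    refine integrable_finsetSum _ fun t ht => ?_
    have ht := Finset.mem_range.1 ht
    exact (hlogi _ (h.measurable_mentorPayoff ht) (hmm t ht)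
      fun ω => (mentorPayoff_mem hpay ht ω).2).sub
      (hlogi _ (h.measurable_agentPayoff ht) (hma t ht) fun ω => (agentPayoff_mem hpay ht ω).2)
  refine ⟨fun ω => hval ω ▸ EReal.coe_ne_top _, hint, ?_⟩
  calc ∫ ω, (I.multiplicativeRegret mentor r T ω).toReal ∂P
      ≤ ∫ ω, 2 / m * (L * r) * ∑ t ∈ Finset.range T, ∑ y, I.mistake mentor t y ω ∂P := by
        refine integral_mono hint ((integrable_finsetSum _ fun t ht => integrable_finsetSum _
          fun y _ => h.integrable_mistake (Finset.mem_range.1 ht) y).const_mul _) fun ω => ?_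
        simp only [hval, EReal.toReal_coe]
        rw [Finset.mul_sum]
        refine Finset.sum_le_sum fun t ht => ?_
        have ht := Finset.mem_range.1 ht
        have ha := hm2.trans_le (hma t ht ω)
        have hmp := hm2.trans_le (hmm t ht ω)
        have hlog : Real.log (I.mentorPayoff mentor t ω) - Real.log (I.agentPayoff mentor r t ω) ≤
            (I.mentorPayoff mentor t ω - I.agentPayoff mentor r t ω) /
              I.agentPayoff mentor r t ω := by
          rw [← Real.log_div hmp.ne' ha.ne', sub_div, div_self ha.ne']
          exact Real.log_le_sub_one_of_pos (div_pos hmp ha)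
        have hnn : 0 ≤ ∑ y, I.mistake mentor t y ω :=
          Finset.sum_nonneg fun y _ => I.mistake_nonneg mentor t y ω
        calc _ ≤ _ := hlog
          _ ≤ (L * r * ∑ y, I.mistake mentor t y ω) / I.agentPayoff mentor r t ω := by
              gcongr
              exact h.mentorPayoff_sub_le_mistakes hL hr hloc ht ω
          _ ≤ (L * r * ∑ y, I.mistake mentor t y ω) / (m / 2) := by
              gcongr
              exact hma t ht ω
          _ = _ := by field_simp
    _ ≤ _ := by
        rw [integral_const_mul, mul_assoc]
        gcongr
        exact h.integral_sum_sum_mistake_le hB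

end Regret

lemma one_add_pow_le {a : ℝ} (ha : 0 ≤ a) (n : ℕ) : (1 + a) ^ n ≤ 2 ^ n * (1 + a ^ n) := by
  have h1 := add_pow_le zero_le_one ha n
  rw [one_pow] at h1
  refine h1.trans ?_
  gcongr
  · norm_num
  · omega

/-- The diameter enters only through the volume bound, and its measurability is not needed. -/
lemma lintegral_queryCount_le {n : ℕ} {X : Set (EuclideanSpace ℝ (Fin n))} {Ω Y : Type*}
    [Fintype Y] [mΩ : MeasurableSpace Ω] {P : Measure Ω} [IsProbabilityMeasure P]
    {I : Interaction Ω X Y} {mentor : X → Y} {T : ℕ} {ε r : ℝ} {cover : Y → Finset (Expert X)}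
    (h : I.IsExecution P mentor T ε r cover) (hr : 0 < r) (hC : ∀ y, (cover y).Nonempty) {B : ℝ}
    (hB : ∀ y, ∑ t ∈ Finset.range T, ∫ ω, I.mistake mentor t y ω ∂P ≤ B) :
    ∫⁻ ω, (I.queryCount mentor r T ω : ENNReal) ∂P ≤
      ENNReal.ofReal (Fintype.card Y * (queryProb T ε * T + B + 2 * 2 ^ n)) +
        ENNReal.ofReal (Fintype.card Y * (2 * 4 ^ n / r ^ n)) *
          ∫⁻ ω, ENNReal.ofReal (I.inputDiam T ω ^ n) ∂P := by
  set Z : Ω → ℝ := fun ω => ∑ y, ∑ t ∈ Finset.range T,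
    ((if I.coin t ω y = true then 1 else 0) + I.mistake mentor t y ω) +
      Fintype.card Y * (2 * 2 ^ n) with hZ
  have hcoin : ∀ t < T, ∀ y, Measurable fun ω => if I.coin t ω y = true then (1 : ℝ) else 0 :=
    fun t ht y => measurable_ite_const (h.measurableSet_coin_eq ht y true) 1 0
  have hcoini : ∀ t < T, ∀ y,
      Integrable (fun ω => if I.coin t ω y = true then (1 : ℝ) else 0) P := fun t ht y =>
    integrable_of_mem_Icc (hcoin t ht y) (fun ω => by split_ifs <;> simp)
      (fun ω => by split_ifs <;> simp)
  have hsi : ∀ t < T, ∀ y, Integrable (fun ω => (if I.coin t ω y = true then (1 : ℝ) else 0) +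
      I.mistake mentor t y ω) P := fun t ht y => (hcoini t ht y).add (h.integrable_mistake ht y)
  have hZi' : Integrable (fun ω => ∑ y, ∑ t ∈ Finset.range T,
      ((if I.coin t ω y = true then 1 else 0) + I.mistake mentor t y ω)) P :=
    integrable_finsetSum _ fun y _ => integrable_finsetSum _ fun t ht =>
      hsi t (Finset.mem_range.1 ht) y
  have hZi : Integrable Z P := hZi'.add (integrable_const _)
  have hZm : Measurable Z := by
    refine (Finset.measurable_fun_sum _ fun y _ => Finset.measurable_fun_sum _ fun t ht => ?_).add
      measurable_const
    exact (hcoin t (Finset.mem_range.1 ht) y).add (h.measurable_mistake (Finset.mem_range.1 ht) y)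
  have hZ0 : ∀ ω, 0 ≤ Z ω := fun ω => by
    refine add_nonneg (Finset.sum_nonneg fun y _ => Finset.sum_nonneg fun t _ =>
      add_nonneg ?_ (I.mistake_nonneg mentor t y ω)) (by positivity)
    split_ifs <;> simp
  have hZint : ∫ ω, Z ω ∂P ≤ Fintype.card Y * (queryProb T ε * T + B + 2 * 2 ^ n) := by
    have h1 : ∀ y, ∫ ω, ∑ t ∈ Finset.range T,
        ((if I.coin t ω y = true then 1 else 0) + I.mistake mentor t y ω) ∂P ≤
          queryProb T ε * T + B := by
      intro y
      rw [integral_finsetSum _ fun t ht => hsi t (Finset.mem_range.1 ht) y]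
      have h2 : ∀ t ∈ Finset.range T, ∫ ω, ((if I.coin t ω y = true then 1 else 0) +
          I.mistake mentor t y ω) ∂P = queryProb T ε + ∫ ω, I.mistake mentor t y ω ∂P := by
        intro t ht
        have ht := Finset.mem_range.1 ht
        rw [integral_add (hcoini t ht y) (h.integrable_mistake ht y),
          h.integral_coin ht hC y (g := fun _ => 1) measurable_const (fun _ => zero_le_one)
            (fun _ => le_rfl)]
        simp
      rw [Finset.sum_congr rfl h2, Finset.sum_add_distrib, Finset.sum_const, Finset.card_range,
        nsmul_eq_mul, mul_comm]
      gcongr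
      exact hB y
    simp only [hZ]
    rw [integral_add hZi' (integrable_const _), integral_finsetSum _ fun y _ =>
      integrable_finsetSum _ fun t ht => hsi t (Finset.mem_range.1 ht) y]
    have h3 := Finset.sum_le_card_nsmul Finset.univ _ _ fun y _ => h1 y
    rw [nsmul_eq_mul, Finset.card_univ] at h3
    simp only [integral_const, probReal_univ, one_smul]
    linarith
  have hpt : ∀ ω, (I.queryCount mentor r T ω : ENNReal) ≤ ENNReal.ofReal (Z ω) +
      ENNReal.ofReal (Fintype.card Y * (2 * 4 ^ n / r ^ n)) *
        ENNReal.ofReal (I.inputDiam T ω ^ n) := by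
    intro ω
    have hD : 0 ≤ I.inputDiam T ω := Metric.diam_nonneg
    rw [← ENNReal.ofReal_mul (by positivity), ← ENNReal.ofReal_add (hZ0 ω) (by positivity),
      ← ENNReal.ofReal_natCast]
    refine ENNReal.ofReal_le_ofReal ((queryCount_le I mentor hr T ω).trans ?_)
    have h1 := one_add_pow_le (a := 2 * I.inputDiam T ω / r) (by positivity) n
    have h2 : (2 : ℝ) ^ n * (1 + (2 * I.inputDiam T ω / r) ^ n) =
        2 ^ n + 4 ^ n / r ^ n * I.inputDiam T ω ^ n := by
      rw [div_pow, mul_pow, show (4 : ℝ) = 2 * 2 by norm_num, mul_pow]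
      ring
    rw [h2] at h1
    have h3 : (Fintype.card Y : ℝ) * (2 * (1 + 2 * I.inputDiam T ω / r) ^ n) ≤
        Fintype.card Y * (2 * (2 ^ n + 4 ^ n / r ^ n * I.inputDiam T ω ^ n)) := by gcongr
    have h4 : (Fintype.card Y : ℝ) * (2 * (2 ^ n + 4 ^ n / r ^ n * I.inputDiam T ω ^ n)) =
        Fintype.card Y * (2 * 2 ^ n) +
          Fintype.card Y * (2 * 4 ^ n / r ^ n) * I.inputDiam T ω ^ n := by ring
    simp only [hZ]
    linarith
  calc ∫⁻ ω, (I.queryCount mentor r T ω : ENNReal) ∂P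
      ≤ ∫⁻ ω, (ENNReal.ofReal (Z ω) + ENNReal.ofReal (Fintype.card Y * (2 * 4 ^ n / r ^ n)) *
        ENNReal.ofReal (I.inputDiam T ω ^ n)) ∂P := lintegral_mono hpt
    _ = ENNReal.ofReal (∫ ω, Z ω ∂P) + ENNReal.ofReal (Fintype.card Y * (2 * 4 ^ n / r ^ n)) *
          ∫⁻ ω, ENNReal.ofReal (I.inputDiam T ω ^ n) ∂P := by
        rw [lintegral_add_left hZm.ennreal_ofReal,
          ofReal_integral_eq_lintegral_ofReal hZi (ae_of_all _ hZ0),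
          lintegral_const_mul' _ _ ENNReal.ofReal_ne_top]
    _ ≤ _ := by gcongr

end Interaction.IsExecution

/-! ### The choice of `ε` and the resulting rates -/

section Parameters

variable {n T : ℕ}

lemma epsilon_pos (hT : 2 ≤ T) : 0 < epsilon n T :=
  Real.rpow_pos_of_pos (by exact_mod_cast (by omega : 0 < T)) _

lemma epsilon_le_one (hT : 2 ≤ T) : epsilon n T ≤ 1 := by
  refine Real.rpow_le_one_of_one_le_of_nonpos (by exact_mod_cast (by omega : 1 ≤ T)) ?_
  exact div_nonpos_of_nonpos_of_nonneg (by simp) (by positivity)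

lemma epsilon_mul (hT : 2 ≤ T) : epsilon n T * T = (T : ℝ) ^ (1 / (2 * n + 1) : ℝ) := by
  have hT0 : (0 : ℝ) < T := by exact_mod_cast (by omega : 0 < T)
  rw [epsilon]
  nth_rewrite 2 [← Real.rpow_one (T : ℝ)]
  rw [← Real.rpow_add hT0]
  congr 1
  field_simp
  ring

lemma one_le_epsilon_mul (hT : 2 ≤ T) : 1 ≤ epsilon n T * T := by
  rw [epsilon_mul hT]
  exact Real.one_le_rpow (by exact_mod_cast (by omega : 1 ≤ T)) (by positivity)

lemma inv_epsilon (n T : ℕ) : (epsilon n T)⁻¹ = (T : ℝ) ^ ((2 * n) / (2 * n + 1) : ℝ) := by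
  rw [epsilon, ← Real.rpow_neg (Nat.cast_nonneg _), neg_div, neg_neg]

lemma inv_epsilon_le (hT : 2 ≤ T) : (epsilon n T)⁻¹ ≤ T := by
  rw [inv_le_iff_one_le_mul₀ (epsilon_pos hT), mul_comm]
  exact one_le_epsilon_mul hT

lemma queryProb_pos (hT : 2 ≤ T) : 0 < queryProb T (epsilon n T) := by
  have := one_le_epsilon_mul (n := n) hT
  unfold queryProb
  positivity

lemma queryProb_le_one (hT : 2 ≤ T) : queryProb T (epsilon n T) ≤ 1 := by
  have h1 := one_le_epsilon_mul (n := n) hT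
  have h2 : 1 ≤ Real.sqrt (epsilon n T * T) := by rwa [Real.one_le_sqrt]
  exact (div_le_one (by linarith)).2 h2

lemma queryProb_sq (hT : 2 ≤ T) : queryProb T (epsilon n T) ^ 2 = (epsilon n T * T)⁻¹ := by
  rw [queryProb, div_pow, one_pow, Real.sq_sqrt (by linarith [one_le_epsilon_mul (n := n) hT]),
    one_div]

lemma queryProb_mul (hT : 2 ≤ T) :
    queryProb T (epsilon n T) * T = (T : ℝ) ^ ((4 * n + 1) / (4 * n + 2) : ℝ) := by
  have hT0 : (0 : ℝ) < T := by exact_mod_cast (by omega : 0 < T)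
  rw [queryProb, epsilon_mul hT, Real.sqrt_eq_rpow, ← Real.rpow_mul hT0.le, one_div,
    ← Real.rpow_neg hT0.le]
  nth_rewrite 2 [← Real.rpow_one (T : ℝ)]
  rw [← Real.rpow_add hT0]
  congr 1
  field_simp
  ring

lemma threshold_eq (hn : 1 ≤ n) (T : ℕ) : threshold n T = (T : ℝ) ^ (-(2 / (2 * n + 1) : ℝ)) := by
  have hn0 : (n : ℝ) ≠ 0 := by exact_mod_cast (by omega : n ≠ 0)
  rw [threshold, epsilon, ← Real.rpow_mul (Nat.cast_nonneg _)]
  congr 1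
  field_simp

lemma threshold_pos (hT : 2 ≤ T) : 0 < threshold n T := Real.rpow_pos_of_pos (epsilon_pos hT) _

lemma threshold_pow (hn : 1 ≤ n) (hT : 2 ≤ T) : threshold n T ^ n = epsilon n T := by
  rw [threshold, one_div, Real.rpow_inv_natCast_pow (epsilon_pos hT).le (by omega)]

lemma threshold_mul (hn : 1 ≤ n) (hT : 2 ≤ T) :
    threshold n T * (T : ℝ) ^ (1 / (2 * n + 1) : ℝ) = (T : ℝ) ^ (-1 / (2 * n + 1) : ℝ) := by
  have hT0 : (0 : ℝ) < T := by exact_mod_cast (by omega : 0 < T)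
  rw [threshold_eq hn, ← Real.rpow_add hT0]
  congr 1
  field_simp
  ring

lemma exists_forall_mul_threshold_le (hn : 1 ≤ n) (L : ℝ) {c : ℝ} (hc : 0 < c) :
    ∃ T₀ : ℕ, ∀ T ≥ T₀, L * threshold n T ≤ c := by
  have h1 : Filter.Tendsto (fun T : ℕ => L * threshold n T) Filter.atTop (nhds (L * 0)) := by
    simp only [threshold_eq hn]
    exact ((tendsto_rpow_neg_atTop (by positivity)).comp tendsto_natCast_atTop_atTop).const_mul L
  rw [mul_zero] at h1
  exact Filter.eventually_atTop.1 (h1.eventually_le_const hc)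

lemma one_le_two_mul_log (hT : 2 ≤ T) : 1 ≤ 2 * Real.log T := by
  have h1 : Real.log 2 ≤ Real.log T := Real.log_le_log two_pos (by exact_mod_cast hT)
  linarith [Real.log_two_gt_d9]

lemma log_card_le {N d : ℕ} {b : ℝ} (hN : 0 < N) (hb : b ≤ (T : ℝ) ^ 7) (hb0 : 0 ≤ b)
    (h : (N : ℝ) ≤ b ^ d) : Real.log N ≤ 7 * (d * Real.log T) := by
  have h1 : (N : ℝ) ≤ ((T : ℝ) ^ 7) ^ d := h.trans (by gcongr)
  refine (Real.log_le_log (by exact_mod_cast hN) h1).trans (le_of_eq ?_)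
  rw [Real.log_pow, Real.log_pow]
  push_cast
  ring

lemma log_card_le_of_smooth {N d : ℕ} (hT : 2 ≤ T) (hN : 0 < N)
    (h : (N : ℝ) ≤ smoothCoverSize d (epsilon n T)) : Real.log N ≤ 7 * (d * Real.log T) := by
  have hT2 : (2 : ℝ) ≤ T := by exact_mod_cast hT
  refine log_card_le hN ?_ (div_nonneg (by norm_num) (epsilon_pos hT).le) h
  calc 41 / epsilon n T ≤ 2 ^ 6 * T := by
        rw [div_eq_mul_inv]
        have := inv_epsilon_le (n := n) hT
        gcongr
        · exact (inv_pos.2 (epsilon_pos hT)).le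
        · norm_num
    _ ≤ (T : ℝ) ^ 6 * T := by gcongr
    _ = (T : ℝ) ^ 7 := by ring

lemma log_card_le_of_adversarial {N d : ℕ} (hd : 1 ≤ d) (hT : 2 ≤ T) (hN : 0 < N)
    (h : (N : ℝ) ≤ adversarialCoverSize d T) : Real.log N ≤ 7 * (d * Real.log T) := by
  have hT2 : (2 : ℝ) ≤ T := by exact_mod_cast hT
  have hd0 : (0 : ℝ) < d := by exact_mod_cast hd
  refine log_card_le hN ?_ (by positivity) h
  have hmax : ((max T d : ℕ) : ℝ) ≤ T * d := by
    have h1 : T ≤ T * d := Nat.le_mul_of_pos_right _ hd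
    have h2 : d ≤ T * d := Nat.le_mul_of_pos_left _ (by omega)
    exact_mod_cast max_le h1 h2
  calc Real.exp 1 * (max T d : ℕ) / d ≤ 2 ^ 6 * (T * d) / d := by
        gcongr
        linarith [Real.exp_one_lt_d9]
    _ = 2 ^ 6 * T := by field_simp
    _ ≤ (T : ℝ) ^ 6 * T := by gcongr
    _ = (T : ℝ) ^ 7 := by ring

end Parameters

section Covers

/-- The cover `C` and the inputs are in one of the two settings of the guarantee: smooth inputs with
a smooth cover of a class of finite VC dimension, or arbitrary inputs with an adversarial cover of a
class of finite Littlestone dimension. -/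
def IsAdmissibleCover {Ω X Y : Type*} [MeasurableSpace Ω] [MeasurableSpace X]
    (P : Measure Ω) (I : Interaction Ω X Y) (H : Set (X → Bool)) (U : Measure X)
    (n T d : ℕ) (σ : ℝ) (C : Finset (Expert X)) : Prop :=
  ((∀ h ∈ H, Measurable h) ∧ vcDim H ≤ d ∧ I.IsSmooth P T U σ ∧
    IsSmoothCover U (epsilon n T) H C ∧ (C.card : ℝ) ≤ smoothCoverSize d (epsilon n T)) ∨
  (littlestoneDim H ≤ d ∧ IsAdversarialCover T H C ∧ (C.card : ℝ) ≤ adversarialCoverSize d T)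

lemma IsAdmissibleCover.nonempty {Ω X Y : Type*} [MeasurableSpace Ω] [MeasurableSpace X]
    {P : Measure Ω} [IsProbabilityMeasure P] {I : Interaction Ω X Y} {U : Measure X} {n T d : ℕ}
    {σ : ℝ} {H : Set (X → Bool)} {C : Finset (Expert X)}
    (h : IsAdmissibleCover P I H U n T d σ C) (hH : H.Nonempty) : C.Nonempty := by
  obtain ⟨f, hf⟩ := hH
  rcases h with ⟨-, -, -, hC, -⟩ | ⟨-, hC, -⟩
  · obtain ⟨e, he, -⟩ := hC.2 f hf
    exact ⟨e, he⟩
  · obtain ⟨ω⟩ := P.nonempty_of_neZero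
    obtain ⟨e, he, -⟩ := hC (I.inputs ω) f hf
    exact ⟨e, he⟩

variable {Ω X Y : Type*} [MetricSpace X] [MeasurableSpace X] [Fintype Y] [mΩ : MeasurableSpace Ω]
  {P : Measure Ω} [IsProbabilityMeasure P] {I : Interaction Ω X Y} {Pol : Set (X → Y)}
  {mentor : X → Y} {n T d : ℕ} {σ : ℝ} {cover : Y → Finset (Expert X)} {U : Measure X}

/-- Smoothness bounds the expected loss of an expert that is close to the mentor under `U`. -/
lemma Interaction.IsExecution.integral_loss_le {ε r : ℝ} {t : ℕ} {y : Y}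
    (h : I.IsExecution P mentor T ε r cover) (hsm : I.IsSmooth P T U σ) (hσ : 0 < σ) (ht : t < T)
    (hf : Measurable (indicatorPolicy mentor y)) {g : X → Bool} (hg : Measurable g) {δ : ℝ}
    (hδ : 0 ≤ δ) (hU : U {x | g x ≠ indicatorPolicy mentor y x} ≤ ENNReal.ofReal δ) :
    ∫ ω, loss (indicatorPolicy mentor y) (I.inputs ω) t (fun _ x => g x) ∂P ≤ δ / σ := by
  set S : Set X := {x | g x ≠ indicatorPolicy mentor y x} with hS
  have hSm : MeasurableSet S := (measurableSet_eq_fun hg hf).compl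
  have hm : I.past t ≤ mΩ := h.past_le t ht.le
  have heq : ∀ ω, loss (indicatorPolicy mentor y) (I.inputs ω) t (fun _ x => g x) =
      Set.indicator (I.input t ⁻¹' S) (fun _ => (1 : ℝ)) ω := by
    intro ω
    unfold loss predict Interaction.inputs
    by_cases hω : g (I.input t ω) = indicatorPolicy mentor y (I.input t ω) <;>
      simp [Set.indicator, hS, hω]
  simp only [heq]
  rw [← integral_condExp hm]
  calc _ ≤ ∫ _, (U S).toReal / σ ∂P :=
        integral_mono_ae integrable_condExp (integrable_const _) (hsm t ht S hSm)
    _ = (U S).toReal / σ := by simp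
    _ ≤ δ / σ := by
        gcongr
        exact ENNReal.toReal_le_of_le_ofReal hδ hU

lemma sum_integral_mistake_le_rate {r : ℝ}
    (h : I.IsExecution P mentor T (epsilon n T) r cover) (hd : 1 ≤ d) (hT : 2 ≤ T) (hσ : 0 < σ)
    (hσ1 : σ ≤ 1) (hmentor : mentor ∈ Pol)
    (hcov : ∀ y, IsAdmissibleCover P I (oneVsRest Pol y) U n T d σ (cover y)) (y : Y) :
    ∑ t ∈ Finset.range T, ∫ ω, I.mistake mentor t y ω ∂P ≤
      27 * ((T : ℝ) ^ (1 / (2 * n + 1) : ℝ) * (d / σ * Real.log T)) := by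
  have hmem : ∀ y, indicatorPolicy mentor y ∈ oneVsRest Pol y := fun y => ⟨mentor, hmentor, rfl⟩
  have hC : ∀ y, (cover y).Nonempty := fun y => (hcov y).nonempty ⟨_, hmem y⟩
  have hε := epsilon_pos (n := n) hT
  have hδ : 0 ≤ epsilon n T / σ := by positivity
  have hcard : 0 < (cover y).card := Finset.card_pos.2 (hC y)
  have key : Real.log (cover y).card ≤ 7 * (d * Real.log T) ∧
      ∑ t ∈ Finset.range T, ∫ ω, I.mistake mentor t y ω ∂P ≤
        3 * (Real.log (cover y).card / queryProb T (epsilon n T) ^ 2) +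
          3 * (T * (epsilon n T / σ)) := by
    rcases hcov y with ⟨hmeas, -, hsm, hcover, hsize⟩ | ⟨-, hcover, hsize⟩
    · refine ⟨log_card_le_of_smooth hT hcard hsize, ?_⟩
      obtain ⟨e, he, hU⟩ := hcover.2 _ (hmem y)
      obtain ⟨g, hg, rfl⟩ := hcover.1 e he
      exact h.sum_integral_mistake_le hC (by omega) (queryProb_pos hT) (queryProb_le_one hT) y
        (fun t ω => loss (indicatorPolicy mentor y) (I.inputs ω) t fun _ x => g x)
        (fun t ht => h.measurable_loss ht he) (fun t _ ω => loss_nonneg _ _ _ _)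
        (fun t _ ω => loss_le_one _ _ _ _)
        (fun t ht => h.integral_loss_le hsm hσ ht (hmeas _ (hmem y)) hg hε.le hU)
        (fun ω => ⟨_, he, fun t _ => le_rfl⟩)
    · refine ⟨log_card_le_of_adversarial hd hT hcard hsize, ?_⟩
      refine h.sum_integral_mistake_le hC (by omega) (queryProb_pos hT) (queryProb_le_one hT) y
        (fun _ _ => 0) (fun _ _ => measurable_const) (fun _ _ _ => le_rfl)
        (fun _ _ _ => zero_le_one) (fun _ _ => by simpa using hδ) (fun ω => ?_)
      obtain ⟨e, he, hpred⟩ := hcover (I.inputs ω) _ (hmem y)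
      exact ⟨e, he, fun t ht => (if_pos (hpred t ht)).le⟩
  obtain ⟨hlog, hsum⟩ := key
  rw [queryProb_sq hT, div_inv_eq_mul, ← mul_div_assoc, mul_comm (T : ℝ), epsilon_mul hT] at hsum
  set τ : ℝ := (T : ℝ) ^ (1 / (2 * n + 1) : ℝ) with hτ
  have hτ0 : 0 ≤ τ := by positivity
  have hd1 : (1 : ℝ) ≤ d := by exact_mod_cast hd
  have hl := one_le_two_mul_log hT
  have h1 : 1 ≤ 2 * (d * Real.log T) := by nlinarith
  have h2 : (d : ℝ) * Real.log T ≤ d / σ * Real.log T := by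
    gcongr
    exact le_div_self (by positivity) hσ hσ1
  have h3 : τ / σ ≤ τ * (2 * (d / σ * Real.log T)) := by
    calc τ / σ = τ / σ * 1 := by ring
      _ ≤ τ / σ * (2 * (d * Real.log T)) := by gcongr
      _ = _ := by ring
  have h4 : Real.log (cover y).card * τ ≤ 7 * (d / σ * Real.log T) * τ := by
    gcongr
    linarith
  linarith

end Covers

end AskForHelp

open AskForHelp in
theorem mainTheorem4 (n : ℕ) (hn : 1 ≤ n) :
    ∃ K : ℝ, 0 < K ∧ ∀ L m : ℝ, 0 < L → 0 < m → ∃ T₀ : ℕ,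
      ∀ (X : Set (EuclideanSpace ℝ (Fin n))) (Y : Type*) [Fintype Y] (Pol : Set (X → Y))
        (d : ℕ) (U : MeasureTheory.Measure X) [MeasureTheory.IsProbabilityMeasure U] (T : ℕ),
        1 ≤ d → 2 ≤ T →
        -- the covers that the algorithm needs exist
        (∀ y, (∀ h ∈ oneVsRest Pol y, Measurable h) → vcDim (oneVsRest Pol y) ≤ d →
          ∃ C : Finset (Expert X), IsSmoothCover U (epsilon n T) (oneVsRest Pol y) C ∧
            (C.card : ℝ) ≤ smoothCoverSize d (epsilon n T)) ∧
        (∀ y, littlestoneDim (oneVsRest Pol y) ≤ d →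
          ∃ C : Finset (Expert X), IsAdversarialCover T (oneVsRest Pol y) C ∧
            (C.card : ℝ) ≤ adversarialCoverSize d T) ∧
        -- guarantees of every execution of the algorithm with any such covers
        ∀ (mentor : X → Y) (_ : mentor ∈ Pol) (σ : ℝ) (_ : 0 < σ) (_ : σ ≤ 1)
          (cover : Y → Finset (Expert X))
          (Ω : Type*) [MeasurableSpace Ω] (P : MeasureTheory.Measure Ω)
          [MeasureTheory.IsProbabilityMeasure P] (I : Interaction Ω X Y),
          I.IsExecution P mentor T (epsilon n T) (threshold n T) cover →
          I.PayoffsInUnitInterval T →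
          I.LocalGeneralization mentor T L →
          I.MentorAtLeast mentor T m →
          (∀ y,
            ((∀ h ∈ oneVsRest Pol y, Measurable h) ∧ vcDim (oneVsRest Pol y) ≤ d ∧
              I.IsSmooth P T U σ ∧
              IsSmoothCover U (epsilon n T) (oneVsRest Pol y) (cover y) ∧
              ((cover y).card : ℝ) ≤ smoothCoverSize d (epsilon n T)) ∨
            (littlestoneDim (oneVsRest Pol y) ≤ d ∧
              IsAdversarialCover T (oneVsRest Pol y) (cover y) ∧
              ((cover y).card : ℝ) ≤ adversarialCoverSize d T)) →
          -- multiplicative regret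
          (T₀ ≤ T →
            (∀ᵐ ω ∂P, I.multiplicativeRegret mentor (threshold n T) T ω ≠ ⊤) ∧
            MeasureTheory.Integrable
              (fun ω => (I.multiplicativeRegret mentor (threshold n T) T ω).toReal) P ∧
            ∫ ω, (I.multiplicativeRegret mentor (threshold n T) T ω).toReal ∂P ≤
              K * (Fintype.card Y * d * L / (σ * m)) *
                (T : ℝ) ^ (-1 / (2 * n + 1) : ℝ) * Real.log T) ∧
          -- additive regret
          (MeasureTheory.Integrable (I.additiveRegret mentor (threshold n T) T) P ∧
            ∫ ω, I.additiveRegret mentor (threshold n T) T ω ∂P ≤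
              K * (Fintype.card Y * d * L / σ) *
                (T : ℝ) ^ (-1 / (2 * n + 1) : ℝ) * Real.log T) ∧
          -- number of queries
          ∫⁻ ω, (I.queryCount mentor (threshold n T) T ω : ENNReal) ∂P ≤
            ENNReal.ofReal (K * Fintype.card Y * (T : ℝ) ^ ((4 * n + 1) / (4 * n + 2) : ℝ)) *
              (ENNReal.ofReal (d / σ * Real.log T) +
                ∫⁻ ω, ENNReal.ofReal (I.inputDiam T ω ^ n) ∂P) := by
  refine ⟨100 * 4 ^ n, by positivity, fun L m hL hm => ?_⟩
  obtain ⟨T₀, hT₀⟩ := exists_forall_mul_threshold_le hn L (half_pos hm)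
  refine ⟨T₀, fun X Y _ Pol d U _ T hd hT => ⟨fun y hmeas hvc => ?_, fun y hl => ?_, ?_⟩⟩
  · exact exists_smoothCover U hmeas hd hvc (epsilon_pos hT) (epsilon_le_one hT)
  · exact exists_adversarialCover hd hl
  intro mentor hmentor σ hσ hσ1 cover Ω _ P _ I h hpay hloc hmin hcov
  set τ : ℝ := (T : ℝ) ^ (1 / (2 * n + 1) : ℝ) with hτ
  set a : ℝ := (T : ℝ) ^ (-1 / (2 * n + 1) : ℝ) with ha
  set q : ℝ := (T : ℝ) ^ ((4 * n + 1) / (4 * n + 2) : ℝ) with hq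
  set Λ : ℝ := d / σ * Real.log T with hΛ
  have hT1 : (1 : ℝ) ≤ T := by exact_mod_cast (by omega : 1 ≤ T)
  have hr := threshold_pos (n := n) hT
  have hB := sum_integral_mistake_le_rate h hd hT hσ hσ1 hmentor hcov
  have hC : ∀ y, (cover y).Nonempty := fun y =>
    IsAdmissibleCover.nonempty (hcov y) ⟨_, mentor, hmentor, rfl⟩
  have hra : threshold n T * τ = a := threshold_mul hn hT
  have hd1 : (1 : ℝ) ≤ d := by exact_mod_cast hd
  have hΛ1 : 1 ≤ 2 * Λ := by
    have h1 : (1 : ℝ) ≤ d / σ := hd1.trans (le_div_self (by positivity) hσ hσ1)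
    have := one_le_two_mul_log hT
    rw [hΛ]
    nlinarith
  have h4n : (1 : ℝ) ≤ 4 ^ n := one_le_pow₀ (by norm_num)
  have ha0 : 0 ≤ a := by positivity
  -- a mistake costs `L r`, and `r ε T` is `T ^ (-1 / (2 n + 1))`
  have hcost : L * threshold n T * (Fintype.card Y * (27 * (τ * Λ))) =
      27 * (Fintype.card Y * d * L / σ) * a * Real.log T := by
    rw [← hra, hΛ]; ring
  have hmain0 : 0 ≤ Fintype.card Y * d * L / σ * a * Real.log T := by
    have := Real.log_nonneg hT1
    positivity
  refine ⟨fun hTT => ?_, ?_, ?_⟩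
  · obtain ⟨h1, h2, h3⟩ := h.integral_multiplicativeRegret_le hL.le hr.le hpay hloc hm hmin
      (hT₀ T hTT) hB
    refine ⟨Filter.Eventually.of_forall h1, h2, h3.trans ?_⟩
    rw [hcost]
    calc 2 / m * (27 * (Fintype.card Y * d * L / σ) * a * Real.log T)
        = 54 * (Fintype.card Y * d * L / σ * a * Real.log T / m) := by ring
      _ ≤ 100 * 4 ^ n * (Fintype.card Y * d * L / σ * a * Real.log T / m) := by
          gcongr
          linarith
      _ = _ := by field_simp
  · obtain ⟨h1, h2⟩ := h.integral_additiveRegret_le hL.le hr.le hpay hloc hB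
    refine ⟨h1, h2.trans ?_⟩
    rw [hcost]
    calc 27 * (Fintype.card Y * d * L / σ) * a * Real.log T
        = 27 * (Fintype.card Y * d * L / σ * a * Real.log T) := by ring
      _ ≤ 100 * 4 ^ n * (Fintype.card Y * d * L / σ * a * Real.log T) := by
          gcongr
          linarith
      _ = _ := by ring
  · refine (h.lintegral_queryCount_le hr hC hB).trans ?_
    have hq1 : 1 ≤ q := Real.one_le_rpow hT1 (by positivity)
    have hτq : τ ≤ q := by
      refine Real.rpow_le_rpow_of_exponent_le hT1 ?_
      rw [div_le_div_iff₀ (by positivity) (by positivity)]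
      have : (1 : ℝ) ≤ n := by exact_mod_cast hn
      nlinarith
    have hεq : (epsilon n T)⁻¹ ≤ q := by
      rw [inv_epsilon]
      refine Real.rpow_le_rpow_of_exponent_le hT1 ?_
      rw [div_le_div_iff₀ (by positivity) (by positivity)]
      nlinarith
    rw [mul_add (ENNReal.ofReal _), ← ENNReal.ofReal_mul (by positivity), queryProb_mul hT,
      threshold_pow hn hT]
    gcongr ENNReal.ofReal ?_ + ENNReal.ofReal ?_ * _
    · have h2n : (2 : ℝ) ^ n ≤ 4 ^ n := by gcongr; norm_num
      have hqΛ : 1 ≤ 2 * (q * Λ) := by nlinarith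
      have e1 : q ≤ 2 * (q * Λ) * 4 ^ n := by
        calc q = q * 1 * 1 := by ring
          _ ≤ q * (2 * Λ) * 4 ^ n := by gcongr
          _ = _ := by ring
      have e2 : 27 * (τ * Λ) ≤ 27 * (q * Λ) * 4 ^ n := by
        calc 27 * (τ * Λ) ≤ 27 * (q * Λ) * 1 := by
              rw [mul_one]
              have : 0 ≤ Λ := by linarith
              gcongr
          _ ≤ _ := by gcongr
      have e3 : 2 * 2 ^ n ≤ 4 * (q * Λ) * 4 ^ n := by
        calc (2 : ℝ) * 2 ^ n ≤ 2 * 4 ^ n * 1 := by linarith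
          _ ≤ 2 * 4 ^ n * (2 * (q * Λ)) := by gcongr
          _ = _ := by ring
      have e4 : 0 ≤ q * Λ * 4 ^ n := by
        have : 0 ≤ q * Λ := by linarith
        positivity
      calc Fintype.card Y * (q + 27 * (τ * Λ) + 2 * 2 ^ n)
          ≤ Fintype.card Y * (100 * 4 ^ n * q * Λ) := by
            gcongr
            linarith
        _ = _ := by ring
    · calc (Fintype.card Y : ℝ) * (2 * 4 ^ n / epsilon n T)
          ≤ Fintype.card Y * (100 * 4 ^ n * q) := by
            rw [div_eq_mul_inv]
            gcongr
            · exact (inv_pos.2 (epsilon_pos hT)).le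
            · norm_num
        _ = _ := by ring
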